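/- **Setting.** Let $\Omega\subset\mathbb{R}^3$ be a bounded Lipschitz domain that is topologically trivial (i.e. simply connected with connected boundary), and let $\mathcal{T}^h$ be a conforming tetrahedral mesh of $\Omega$ (a finite simplicial complex with tetrahedra as maximal simplices whose union is $\overline\Omega$). Define - $\tilde V_h=\{v\in H_0(\operatorname{curl};\Omega): \forall T\in\mathcal{T}^h\ \exists a,b\in\mathbb{R}^3:\ v(x)=a+b\times x \text{ for } x\in T\}$, the lowest-order Nédélec space with zero boundary conditions; - $S_h=\{s\in H^1_0(\Omega): s|_T \text{ is affine for all } T\in\mathcal{T}^h\}$; - $Q_h=\{J\in L^2(\Omega)^3 : J|_T \text{ is constant for all } T\in\mathcal{T}^h\}$; and let $V_h\subset\tilde V_h$ be any subspace with $\tilde V_h=\nabla S_h\oplus V_h$ (direct sum). Let $\nu_0,A_s,J_s>0$ and $\chi\ge 0$. Let $j_s\in L^2(\Omega)^3$ be of the form $j_s=\operatorname{curl}H_s$ (weakly) with $H_s\in H(\operatorname{curl};\Omega)$. Let $U(J)=-\frac{2A_sJ_s}{\pi}\log\bigl(\cos\bigl(\frac{\pi}{2}\frac{|J|}{J_s}\bigr)\bigr)$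 for $|J|<J_s$ and $U(J)=+\infty$ for $|J|\ge J_s$. For $\varepsilon\ge 0$ write $|x|_\varepsilon=\sqrt{|x|^2+\varepsilon}$. **Theorem.** For every $\varepsilon\ge 0$ and every $J_p\in Q_h$, the problem $$\min_{A_h\in V_h}\ \min_{J_h\in Q_h}\ \int_\Omega \frac{\nu_0}{2}\,|\operatorname{curl}A_h-J_h|^2-\langle j_s,A_h\rangle+U(J_h)+\chi\,|J_h-J_p|_\varepsilon\,dx$$ has a unique solution: there is exactly one pair $(A_h,J_h)\in V_h\times Q_h$ at which the functional, with values in $(-\infty,+\infty]$, attains its minimum over $V_h\times Q_h$. -/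

import Mathlib

open MeasureTheory Topology TopologicalSpace
open scoped ENNReal NNReal Distributions

noncomputable section

namespace HystFEM

/-- Euclidean three-space. -/
abbrev E3 := EuclideanSpace ℝ (Fin 3)

/-! ### Domains -/

/-- A bounded Lipschitz domain: a bounded connected open set which, near each of its boundary
points and in suitable orthonormal coordinates, is the strict epigraph of a Lipschitz function. -/
structure IsBoundedLipschitzDomain (Ω : Opens E3) : Prop where
  connected : IsConnected (Ω : Set E3)
  bounded : Bornology.IsBounded (Ω : Set E3)
  lipschitz : ∀ x ∈ frontier (Ω : Set E3),
    ∃ (e : E3 ≃ₗᵢ[ℝ] E3) (K : ℝ≥0) (γ : EuclideanSpace ℝ (Fin 2) → ℝ), LipschitzWith K γ ∧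
      ∀ᶠ y in 𝓝 x, (y ∈ Ω ↔ γ !₂[e y 0, e y 1] < e y 2)

/-- Topologically trivial domains: simply connected with connected boundary. -/
def IsTopologicallyTrivial (Ω : Opens E3) : Prop :=
  SimplyConnectedSpace Ω ∧ IsConnected (frontier (Ω : Set E3))

/-! ### Classical differential operators -/

/-- The partial derivative `∂_i f_j` at `x`. -/
def partialD (f : E3 → E3) (i j : Fin 3) (x : E3) : ℝ :=
  (fderiv ℝ f x (EuclideanSpace.single i 1)) j

/-- The classical curl of a vector field. -/
def curl (f : E3 → E3) (x : E3) : E3 :=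
  !₂[partialD f 1 2 x - partialD f 2 1 x,
     partialD f 2 0 x - partialD f 0 2 x,
     partialD f 0 1 x - partialD f 1 0 x]

/-- The classical divergence of a vector field. -/
def divergence (f : E3 → E3) (x : E3) : ℝ := ∑ i, partialD f i i x

/-- The cross product on Euclidean three-space. -/
def cross (a b : E3) : E3 := WithLp.toLp 2 (crossProduct (WithLp.ofLp a) (WithLp.ofLp b))

/-! ### Lebesgue and Sobolev spaces -/

/-- `L²(Ω)`. -/
abbrev L2s (Ω : Opens E3) := Lp ℝ 2 ((volume : Measure E3).restrict (Ω : Set E3))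

/-- `L²(Ω)³`. -/
abbrev L2v (Ω : Opens E3) := Lp E3 2 ((volume : Measure E3).restrict (Ω : Set E3))

/-- `w` is the weak curl of `u` in `Ω`. Thus `H(curl; Ω)` consists of the `u : L2v Ω` for which
such a `w : L2v Ω` exists. -/
def IsWeakCurl (Ω : Opens E3) (u w : L2v Ω) : Prop :=
  ∀ φ : 𝓓(Ω, E3),
    ∫ x in (Ω : Set E3), inner ℝ (u x) (curl φ x) = ∫ x in (Ω : Set E3), inner ℝ (w x) (φ x)

/-- `g` is the weak gradient of `s` in `Ω`. -/
def IsWeakGrad (Ω : Opens E3) (s : L2s Ω) (g : L2v Ω) : Prop :=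
  ∀ φ : 𝓓(Ω, E3),
    ∫ x in (Ω : Set E3), s x * divergence φ x = -∫ x in (Ω : Set E3), inner ℝ (g x) (φ x)

open Classical in
/-- The weak curl of a field of `H(curl; Ω)` (and `0` for other fields). -/
def weakCurl (Ω : Opens E3) (u : L2v Ω) : L2v Ω :=
  if h : ∃ w, IsWeakCurl Ω u w then h.choose else 0

/-- Membership in `H₀(curl; Ω)`, the closure of the smooth compactly supported fields
in the norm of `H(curl; Ω)`. -/
def MemH0curl (Ω : Opens E3) (u : L2v Ω) : Prop :=
  ∃ (w : L2v Ω) (φ : ℕ → 𝓓(Ω, E3)),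
    Filter.Tendsto (fun n => eLpNorm (fun x => φ n x - u x) 2
      ((volume : Measure E3).restrict (Ω : Set E3))) Filter.atTop (𝓝 0) ∧
    Filter.Tendsto (fun n => eLpNorm (fun x => curl (φ n) x - w x) 2
      ((volume : Measure E3).restrict (Ω : Set E3))) Filter.atTop (𝓝 0)

/-- Membership in `H¹₀(Ω)`, the closure of the smooth compactly supported functions
in the norm of `H¹(Ω)`. -/
def MemH10 (Ω : Opens E3) (s : L2s Ω) : Prop :=
  ∃ (g : L2v Ω) (φ : ℕ → 𝓓(Ω, ℝ)),
    Filter.Tendsto (fun n => eLpNorm (fun x => φ n x - s x) 2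
      ((volume : Measure E3).restrict (Ω : Set E3))) Filter.atTop (𝓝 0) ∧
    Filter.Tendsto (fun n => eLpNorm (fun x => gradient (φ n) x - g x) 2
      ((volume : Measure E3).restrict (Ω : Set E3))) Filter.atTop (𝓝 0)

/-! ### Meshes and finite element spaces -/

/-- `K` is a (conforming) tetrahedral mesh of `Ω`: a finite simplicial complex, all of whose
maximal simplices are tetrahedra, which covers the closure of `Ω`. -/
structure IsTetMesh (Ω : Opens E3) (K : Geometry.SimplicialComplex ℝ E3) : Prop where
  finite : K.faces.Finite
  pure : ∀ s ∈ K.facets, s.card = 4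
  space_eq : K.space = closure (Ω : Set E3)

/-- `T` is the vertex set of a tetrahedron of the mesh `K`. -/
def IsCell (K : Geometry.SimplicialComplex ℝ E3) (T : Finset E3) : Prop :=
  T ∈ K.faces ∧ T.card = 4

/-- `f = p` almost everywhere on the tetrahedron with vertex set `T`. -/
def EqOnCell {F : Type*} (Ω : Opens E3) (T : Finset E3) (f p : E3 → F) : Prop :=
  ∀ᵐ x ∂((volume : Measure E3).restrict (Ω : Set E3)), x ∈ convexHull ℝ (T : Set E3) → f x = p x

/-- Membership in `S_h`: functions in `H¹₀(Ω)` which are affine on each tetrahedron. -/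
def MemSh (Ω : Opens E3) (K : Geometry.SimplicialComplex ℝ E3) (s : L2s Ω) : Prop :=
  MemH10 Ω s ∧ ∀ T, IsCell K T →
    ∃ (c : ℝ) (b : E3), EqOnCell Ω T s (fun x => c + inner ℝ b x)

/-- Membership in the lowest order Nédélec space with zero boundary conditions: fields in
`H₀(curl; Ω)` which are of the form `a + b × x` on each tetrahedron. -/
def MemNedelec (Ω : Opens E3) (K : Geometry.SimplicialComplex ℝ E3) (v : L2v Ω) : Prop :=
  MemH0curl Ω v ∧ ∀ T, IsCell K T →
    ∃ a b : E3, EqOnCell Ω T v (fun x => a + cross b x)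

/-! ### Linearity of the defining conditions -/

section Linearity

lemma curl_add {f g : E3 → E3} (hf : ContDiff ℝ 1 f) (hg : ContDiff ℝ 1 g) (x : E3) :
    curl (fun y => f y + g y) x = curl f x + curl g x := by
  have hf' := hf.differentiable one_ne_zero x
  have hg' := hg.differentiable one_ne_zero x
  ext i
  fin_cases i <;> simp [curl, partialD, fderiv_fun_add hf' hg'] <;> ring

lemma curl_smul (c : ℝ) (f : E3 → E3) (x : E3) :
    curl (fun y => c • f y) x = c • curl f x := by
  have h : fderiv ℝ (fun y => c • f y) x = c • fderiv ℝ f x :=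
    congrFun (fderiv_const_smul_field c) x
  ext i
  fin_cases i <;> simp [curl, partialD, h] <;> ring

lemma continuous_partialD {f : E3 → E3} (hf : ContDiff ℝ 1 f) (i j : Fin 3) :
    Continuous (partialD f i j) := by
  have h := hf.continuous_fderiv one_ne_zero
  unfold partialD
  fun_prop

lemma continuous_curl {f : E3 → E3} (hf : ContDiff ℝ 1 f) : Continuous (curl f) := by
  have h := continuous_partialD hf
  refine (PiLp.continuous_toLp 2 _).comp (continuous_pi fun i => ?_)
  fin_cases i <;> simp <;> exact (h _ _).sub (h _ _)

lemma gradient_add {f g : E3 → ℝ} (hf : ContDiff ℝ 1 f) (hg : ContDiff ℝ 1 g) (x : E3) :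
    gradient (fun y => f y + g y) x = gradient f x + gradient g x := by
  have hf' := hf.differentiable one_ne_zero x
  have hg' := hg.differentiable one_ne_zero x
  simp [gradient, fderiv_fun_add hf' hg']

lemma gradient_smul (c : ℝ) (f : E3 → ℝ) (x : E3) :
    gradient (fun y => c • f y) x = c • gradient f x := by
  have h : fderiv ℝ (fun y => c • f y) x = c • fderiv ℝ f x :=
    congrFun (fderiv_const_smul_field c) x
  simp only [gradient, h, map_smul]

lemma continuous_gradient {f : E3 → ℝ} (hf : ContDiff ℝ 1 f) : Continuous (gradient f) := by
  have h := hf.continuous_fderiv one_ne_zero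
  unfold gradient
  fun_prop

lemma contDiff_one_test {F : Type*} [NormedAddCommGroup F] [NormedSpace ℝ F] {Ω : Opens E3}
    (φ : 𝓓(Ω, F)) : ContDiff ℝ 1 φ :=
  φ.contDiff.of_le (by exact_mod_cast le_top)

variable {F : Type*} [NormedAddCommGroup F] {μ : Measure E3}

lemma tendsto_add_Lp {f g h : ℕ → E3 → F} {u v : Lp F 2 μ}
    (hf : ∀ n, AEStronglyMeasurable (f n) μ) (hg : ∀ n, AEStronglyMeasurable (g n) μ)
    (hh : ∀ n x, h n x = f n x + g n x)
    (hfu : Filter.Tendsto (fun n => eLpNorm (fun x => f n x - u x) 2 μ) Filter.atTop (𝓝 0))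
    (hgv : Filter.Tendsto (fun n => eLpNorm (fun x => g n x - v x) 2 μ) Filter.atTop (𝓝 0)) :
    Filter.Tendsto (fun n => eLpNorm (fun x => h n x - (u + v : Lp F 2 μ) x) 2 μ)
      Filter.atTop (𝓝 0) := by
  have h0 := hfu.add hgv
  rw [add_zero] at h0
  refine tendsto_of_tendsto_of_tendsto_of_le_of_le tendsto_const_nhds h0
    (fun _ => zero_le) fun n => ?_
  have e : (fun x => h n x - (u + v : Lp F 2 μ) x) =ᵐ[μ]
      (fun x => f n x - u x) + (fun x => g n x - v x) := by
    filter_upwards [Lp.coeFn_add u v] with x hx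
    simp only [hx, hh, Pi.add_apply]
    abel
  simp only [eLpNorm_congr_ae e]
  exact eLpNorm_add_le ((hf n).sub (Lp.aestronglyMeasurable u))
    ((hg n).sub (Lp.aestronglyMeasurable v)) (by norm_num)

lemma tendsto_smul_Lp [NormedSpace ℝ F] (c : ℝ) {f h : ℕ → E3 → F} {u : Lp F 2 μ}
    (hh : ∀ n x, h n x = c • f n x)
    (hfu : Filter.Tendsto (fun n => eLpNorm (fun x => f n x - u x) 2 μ) Filter.atTop (𝓝 0)) :
    Filter.Tendsto (fun n => eLpNorm (fun x => h n x - (c • u : Lp F 2 μ) x) 2 μ)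
      Filter.atTop (𝓝 0) := by
  have h0 := ENNReal.Tendsto.const_mul hfu (a := ‖c‖ₑ) (Or.inr (by simp))
  rw [mul_zero] at h0
  refine h0.congr fun n => ?_
  have e : (fun x => h n x - (c • u : Lp F 2 μ) x) =ᵐ[μ] c • (fun x => f n x - u x) := by
    filter_upwards [Lp.coeFn_smul c u] with x hx
    simp only [hx, hh, Pi.smul_apply, smul_sub]
  rw [eLpNorm_congr_ae e, eLpNorm_const_smul]

lemma tendsto_zero_Lp :
    Filter.Tendsto (fun _ : ℕ => eLpNorm (fun x => (0 : F) - (0 : Lp F 2 μ) x) 2 μ)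
      Filter.atTop (𝓝 0) := by
  have e : (fun x => (0 : F) - (0 : Lp F 2 μ) x) =ᵐ[μ] 0 := by
    filter_upwards [Lp.coeFn_zero F 2 μ] with x hx
    rw [hx]
    simp
  simp only [eLpNorm_congr_ae e, eLpNorm_zero]
  exact tendsto_const_nhds

variable {Ω : Opens E3}

lemma MemH0curl.add {u v : L2v Ω} (hu : MemH0curl Ω u) (hv : MemH0curl Ω v) :
    MemH0curl Ω (u + v) := by
  obtain ⟨w, φ, h1, h2⟩ := hu
  obtain ⟨w', ψ, h3, h4⟩ := hv
  refine ⟨w + w', fun n => φ n + ψ n,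
    tendsto_add_Lp (fun n => (φ n).continuous.aestronglyMeasurable)
      (fun n => (ψ n).continuous.aestronglyMeasurable) (fun _ _ => rfl) h1 h3,
    tendsto_add_Lp
      (fun n => (continuous_curl (contDiff_one_test (φ n))).aestronglyMeasurable)
      (fun n => (continuous_curl (contDiff_one_test (ψ n))).aestronglyMeasurable)
      (fun n x => curl_add (contDiff_one_test (φ n)) (contDiff_one_test (ψ n)) x) h2 h4⟩

lemma MemH0curl.smul (c : ℝ) {u : L2v Ω} (hu : MemH0curl Ω u) : MemH0curl Ω (c • u) := by
  obtain ⟨w, φ, h1, h2⟩ := hu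
  exact ⟨c • w, fun n => c • φ n, tendsto_smul_Lp c (fun _ _ => rfl) h1,
    tendsto_smul_Lp c (fun n x => curl_smul c (φ n) x) h2⟩

lemma MemH0curl.zero : MemH0curl Ω 0 := by
  refine ⟨0, fun _ => 0, tendsto_zero_Lp, ?_⟩
  have : ∀ x, curl (0 : 𝓓(Ω, E3)) x = 0 := fun x => by
    ext i
    fin_cases i <;> simp [curl, partialD]
  simpa only [this] using tendsto_zero_Lp

lemma MemH10.add {u v : L2s Ω} (hu : MemH10 Ω u) (hv : MemH10 Ω v) : MemH10 Ω (u + v) := by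
  obtain ⟨w, φ, h1, h2⟩ := hu
  obtain ⟨w', ψ, h3, h4⟩ := hv
  refine ⟨w + w', fun n => φ n + ψ n,
    tendsto_add_Lp (fun n => (φ n).continuous.aestronglyMeasurable)
      (fun n => (ψ n).continuous.aestronglyMeasurable) (fun _ _ => rfl) h1 h3,
    tendsto_add_Lp
      (fun n => (continuous_gradient (contDiff_one_test (φ n))).aestronglyMeasurable)
      (fun n => (continuous_gradient (contDiff_one_test (ψ n))).aestronglyMeasurable)
      (fun n x => gradient_add (contDiff_one_test (φ n)) (contDiff_one_test (ψ n)) x) h2 h4⟩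

lemma MemH10.smul (c : ℝ) {u : L2s Ω} (hu : MemH10 Ω u) : MemH10 Ω (c • u) := by
  obtain ⟨w, φ, h1, h2⟩ := hu
  exact ⟨c • w, fun n => c • φ n, tendsto_smul_Lp c (fun _ _ => rfl) h1,
    tendsto_smul_Lp c (fun n x => gradient_smul c (φ n) x) h2⟩

lemma MemH10.zero : MemH10 Ω 0 := by
  refine ⟨0, fun _ => 0, tendsto_zero_Lp, ?_⟩
  have : ∀ x, gradient (0 : 𝓓(Ω, ℝ)) x = 0 := fun x => by
    simp [gradient]
  simpa only [this] using tendsto_zero_Lp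

lemma EqOnCell.add {T : Finset E3} {u v : Lp F 2 (volume.restrict (Ω : Set E3))}
    {p q r : E3 → F} (hu : EqOnCell Ω T u p) (hv : EqOnCell Ω T v q)
    (hr : ∀ x, r x = p x + q x) :
    EqOnCell Ω T (u + v : Lp F 2 (volume.restrict (Ω : Set E3))) r := by
  unfold EqOnCell at *
  filter_upwards [hu, hv, Lp.coeFn_add u v] with x h1 h2 h3 hx
  rw [h3, Pi.add_apply, h1 hx, h2 hx, hr]

lemma EqOnCell.smul [NormedSpace ℝ F] (c : ℝ) {T : Finset E3} {u : Lp F 2 (volume.restrict (Ω : Set E3))}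
    {p r : E3 → F} (hu : EqOnCell Ω T u p) (hr : ∀ x, r x = c • p x) :
    EqOnCell Ω T (c • u : Lp F 2 (volume.restrict (Ω : Set E3))) r := by
  unfold EqOnCell at *
  filter_upwards [hu, Lp.coeFn_smul c u] with x h1 h3 hx
  rw [h3, Pi.smul_apply, h1 hx, hr]

lemma EqOnCell.zero {T : Finset E3} {r : E3 → F} (hr : ∀ x, r x = 0) :
    EqOnCell Ω T (0 : Lp F 2 (volume.restrict (Ω : Set E3))) r := by
  unfold EqOnCell
  filter_upwards [Lp.coeFn_zero F 2 (volume.restrict (Ω : Set E3))] with x h3 hx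
  rw [h3, hr, Pi.zero_apply]

lemma cross_add_left (a b x : E3) : cross (a + b) x = cross a x + cross b x := by
  simp [cross]

lemma cross_smul_left (c : ℝ) (b x : E3) : cross (c • b) x = c • cross b x := by
  simp [cross]

lemma integrable_divergence (s : L2s Ω) (φ : 𝓓(Ω, E3)) :
    Integrable (fun x => s x * divergence φ x) (volume.restrict (Ω : Set E3)) := by
  have hc : Continuous (divergence φ) :=
    continuous_finsetSum _ fun i _ => continuous_partialD (contDiff_one_test φ) i i
  have hs : HasCompactSupport (divergence φ) := by
    refine φ.hasCompactSupport.mono' fun x hx => ?_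
    by_contra h
    refine hx ?_
    have : fderiv ℝ φ x = 0 := by
      by_contra h'
      exact h (support_fderiv_subset ℝ h')
    simp [divergence, partialD, this]
  have h : MemLp (divergence φ) 2 (volume.restrict (Ω : Set E3)) :=
    (hc.memLp_of_hasCompactSupport hs).restrict _
  exact (Lp.memLp s).integrable_mul h

lemma integrable_inner_test (g : L2v Ω) (φ : 𝓓(Ω, E3)) :
    Integrable (fun x => inner ℝ (g x) (φ x)) (volume.restrict (Ω : Set E3)) := by
  have h : MemLp φ 2 (volume.restrict (Ω : Set E3)) :=
    (φ.continuous.memLp_of_hasCompactSupport φ.hasCompactSupport).restrict _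
  refine (L2.integrable_inner (𝕜 := ℝ) g (h.toLp φ)).congr ?_
  filter_upwards [h.coeFn_toLp] with x hx
  rw [hx]

lemma IsWeakGrad.add {s t : L2s Ω} {g k : L2v Ω} (hs : IsWeakGrad Ω s g)
    (ht : IsWeakGrad Ω t k) : IsWeakGrad Ω (s + t) (g + k) := by
  intro φ
  have e1 : ∫ x in (Ω : Set E3), (s + t : L2s Ω) x * divergence φ x =
      ∫ x in (Ω : Set E3), (s x * divergence φ x + t x * divergence φ x) := by
    refine integral_congr_ae ?_
    filter_upwards [Lp.coeFn_add s t] with x hx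
    rw [hx, Pi.add_apply, add_mul]
  have e2 : ∫ x in (Ω : Set E3), inner ℝ ((g + k : L2v Ω) x) (φ x) =
      ∫ x in (Ω : Set E3), (inner ℝ (g x) (φ x) + inner ℝ (k x) (φ x)) := by
    refine integral_congr_ae ?_
    filter_upwards [Lp.coeFn_add g k] with x hx
    simp only [hx, Pi.add_apply, inner_add_left]
  rw [e1, e2, integral_add (integrable_divergence s φ) (integrable_divergence t φ),
    integral_add (integrable_inner_test g φ) (integrable_inner_test k φ), hs φ, ht φ]
  ring

lemma IsWeakGrad.smul (c : ℝ) {s : L2s Ω} {g : L2v Ω} (hs : IsWeakGrad Ω s g) :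
    IsWeakGrad Ω (c • s) (c • g) := by
  intro φ
  have e1 : ∫ x in (Ω : Set E3), (c • s : L2s Ω) x * divergence φ x =
      ∫ x in (Ω : Set E3), c * (s x * divergence φ x) := by
    refine integral_congr_ae ?_
    filter_upwards [Lp.coeFn_smul c s] with x hx
    rw [hx, Pi.smul_apply, smul_eq_mul, mul_assoc]
  have e2 : ∫ x in (Ω : Set E3), inner ℝ ((c • g : L2v Ω) x) (φ x) =
      ∫ x in (Ω : Set E3), c * inner ℝ (g x) (φ x) := by
    refine integral_congr_ae ?_
    filter_upwards [Lp.coeFn_smul c g] with x hx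
    simp only [hx, Pi.smul_apply, real_inner_smul_left]
  rw [e1, e2, integral_const_mul, integral_const_mul, hs φ]
  ring

lemma IsWeakGrad.zero : IsWeakGrad Ω 0 0 := by
  intro φ
  have e1 : ∫ x in (Ω : Set E3), (0 : L2s Ω) x * divergence φ x = 0 := by
    refine integral_eq_zero_of_ae ?_
    filter_upwards [Lp.coeFn_zero ℝ 2 (volume.restrict (Ω : Set E3))] with x hx
    rw [hx]
    simp
  have e2 : ∫ x in (Ω : Set E3), inner ℝ ((0 : L2v Ω) x) (φ x) = 0 := by
    refine integral_eq_zero_of_ae ?_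
    filter_upwards [Lp.coeFn_zero E3 2 (volume.restrict (Ω : Set E3))] with x hx
    rw [hx]
    simp
  rw [e1, e2, neg_zero]

end Linearity

/-! ### The discrete spaces and the discrete energy -/

/-- The lowest order Nédélec space with zero boundary conditions. -/
def nedelec (Ω : Opens E3) (K : Geometry.SimplicialComplex ℝ E3) : Submodule ℝ (L2v Ω) where
  carrier := {v | MemNedelec Ω K v}
  add_mem' := by
    rintro u v ⟨hu, hu'⟩ ⟨hv, hv'⟩
    refine ⟨hu.add hv, fun T hT => ?_⟩
    obtain ⟨a, b, h⟩ := hu' T hT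
    obtain ⟨a', b', h'⟩ := hv' T hT
    refine ⟨a + a', b + b', h.add h' fun x => ?_⟩
    rw [cross_add_left]
    abel
  zero_mem' := ⟨MemH0curl.zero, fun T _ => ⟨0, 0, EqOnCell.zero fun x => by simp [cross]⟩⟩
  smul_mem' := by
    rintro c u ⟨hu, hu'⟩
    refine ⟨hu.smul c, fun T hT => ?_⟩
    obtain ⟨a, b, h⟩ := hu' T hT
    refine ⟨c • a, c • b, h.smul c fun x => ?_⟩
    rw [cross_smul_left, smul_add]

/-- `∇S_h`, the space of weak gradients of functions in `S_h`. -/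
def gradSh (Ω : Opens E3) (K : Geometry.SimplicialComplex ℝ E3) : Submodule ℝ (L2v Ω) where
  carrier := {g | ∃ s : L2s Ω, MemSh Ω K s ∧ IsWeakGrad Ω s g}
  add_mem' := by
    rintro g k ⟨s, ⟨hs, hs'⟩, hg⟩ ⟨t, ⟨ht, ht'⟩, hk⟩
    refine ⟨s + t, ⟨hs.add ht, fun T hT => ?_⟩, hg.add hk⟩
    obtain ⟨a, b, h⟩ := hs' T hT
    obtain ⟨a', b', h'⟩ := ht' T hT
    refine ⟨a + a', b + b', h.add h' fun x => ?_⟩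
    rw [inner_add_left]
    ring
  zero_mem' := ⟨0, ⟨MemH10.zero, fun T _ => ⟨0, 0, EqOnCell.zero fun x => by simp⟩⟩,
    IsWeakGrad.zero⟩
  smul_mem' := by
    rintro c g ⟨s, ⟨hs, hs'⟩, hg⟩
    refine ⟨c • s, ⟨hs.smul c, fun T hT => ?_⟩, hg.smul c⟩
    obtain ⟨a, b, h⟩ := hs' T hT
    refine ⟨c * a, c • b, h.smul c fun x => ?_⟩
    rw [real_inner_smul_left, smul_eq_mul, mul_add]

/-- `Q_h`, the space of piecewise constant vector fields. -/
def Qh (Ω : Opens E3) (K : Geometry.SimplicialComplex ℝ E3) : Submodule ℝ (L2v Ω) where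
  carrier := {J | ∀ T, IsCell K T → ∃ c : E3, EqOnCell Ω T J (fun _ => c)}
  add_mem' := by
    intro u v hu hv T hT
    obtain ⟨a, h⟩ := hu T hT
    obtain ⟨b, h'⟩ := hv T hT
    exact ⟨a + b, h.add h' fun _ => rfl⟩
  zero_mem' := fun T _ => ⟨0, EqOnCell.zero fun _ => rfl⟩
  smul_mem' := by
    intro c u hu T hT
    obtain ⟨a, h⟩ := hu T hT
    exact ⟨c • a, h.smul c fun _ => rfl⟩

/-- `V` is a gauged subspace: the Nédélec space is the direct sum of `∇S_h` and `V`. -/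
def IsGauged (Ω : Opens E3) (K : Geometry.SimplicialComplex ℝ E3)
    (V : Submodule ℝ (L2v Ω)) : Prop :=
  gradSh Ω K ⊔ V = nedelec Ω K ∧ gradSh Ω K ⊓ V = ⊥

/-- The internal energy density `U(J) = -(2 A_s J_s / π) log (cos (π/2 · |J| / J_s))`, with value
`∞` outside of its domain `|J| < J_s`. On the domain, the expression is nonnegative. -/
def energyDensity (As Js : ℝ) (J : E3) : ℝ≥0∞ :=
  if ‖J‖ < Js then
    ENNReal.ofReal (-(2 * As * Js / Real.pi) * Real.log (Real.cos (Real.pi / 2 * (‖J‖ / Js))))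
  else ⊤

/-- The regularized norm `|x|_ε`. -/
def regNorm (ε : ℝ) (x : E3) : ℝ := Real.sqrt (‖x‖ ^ 2 + ε)

/-- The functional
`∫ ν₀/2 |curl A - J|² - ⟨j_s, A⟩ + U(J) + χ |J - J_p|_ε dx` with values in `(-∞, ∞]`: the
nonnegative terms are integrated in `[0, ∞]`, the remaining term `⟨j_s, A⟩` is integrable. -/
def discreteEnergy (Ω : Opens E3) (ν₀ As Js χ ε : ℝ) (js Jp A J : L2v Ω) : EReal :=
  ((∫⁻ x in (Ω : Set E3),
      (ENNReal.ofReal (ν₀ / 2 * ‖weakCurl Ω A x - J x‖ ^ 2) + energyDensity As Js (J x)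
        + ENNReal.ofReal (χ * regNorm ε (J x - Jp x))) : ℝ≥0∞) : EReal)
    - ((∫ x in (Ω : Set E3), inner ℝ (js x) (A x) : ℝ) : EReal)

end HystFEM

end

/-! The functional is coercive, lower semicontinuous and strictly midpoint convex where finite, on
the finite-dimensional space `V_h × Q_h`. The direct method gives existence, strict convexity gives
uniqueness. Apart from a linear term the energy sees `A` only through its curl, so both halves need
the curl to be injective on `V_h` (`ker_curlMap_eq_bot`). Since `V_h` meets `∇S_h` trivially, this
reduces to exactness of the discrete complex: a curl-free Nédélec field is the gradient of a
function in `S_h` (`mem_gradSh_of_isWeakCurl_zero`).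

Exactness is proved on the whole space. Membership in `H₀(curl)` makes the extension of `u` by zero
curl-free on `ℝ³` (`isCurlFree_indicator`). Its mollifications have symmetric derivatives, which
forces `b = 0` in `a + b × x` on every cell, so `u` is piecewise constant and bounded. The mollified
fields have potentials by the Poincaré lemma; these are equi-Lipschitz, and a limit is a Lipschitz
potential, affine wherever `u` is constant (`exists_lipschitz_potential`). It is locally constant in
the exterior, and connectedness of the Lipschitz boundary makes it a single constant on the
complement of `Ω` (`exists_eq_const_compl`). After subtracting that constant, truncation and
mollification show that the potential lies in `H¹₀` (`exists_test_tendsto_of_lipschitz`).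

For the variational part, `U` is continuous into `[0, ∞]`, so Fatou gives lower semicontinuity
(`lowerSemicontinuous_nonnegEnergy`). Finite energy forces `|J| < J_s`, which bounds `J`; the
quadratic term then bounds `curl A`, hence `A`, and dominates the linear term
(`exists_bound_of_totalEnergy_le`). Strict convexity of `U` determines `J`, then the quadratic term
determines `curl A` (`density_midpoint`), and injectivity of the curl determines `A`. -/

noncomputable section

namespace HystFEM

/-! ### Mollification of functions and of curl-free fields. -/

section Mollification

variable {F : Type*} [NormedAddCommGroup F] [NormedSpace ℝ F]

/-- The mollification of `f` by a smooth bump function. -/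
def mollify (ρ : ContDiffBump (0 : E3)) (f : E3 → F) : E3 → F :=
  convolution (ρ.normed volume) f (ContinuousLinearMap.lsmul ℝ ℝ) volume

lemma mollify_apply (ρ : ContDiffBump (0 : E3)) (f : E3 → F) (x : E3) :
    mollify ρ f x = ∫ t, ρ.normed volume t • f (x - t) := rfl

lemma integrable_mollify (ρ : ContDiffBump (0 : E3)) {f : E3 → F}
    (hf : LocallyIntegrable f volume) (x : E3) :
    Integrable (fun t => ρ.normed volume t • f (x - t)) :=
  ρ.hasCompactSupport_normed.convolutionExists_left (ContinuousLinearMap.lsmul ℝ ℝ)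
    ρ.continuous_normed hf x

lemma contDiff_mollify (ρ : ContDiffBump (0 : E3)) {f : E3 → F}
    (hf : LocallyIntegrable f volume) : ContDiff ℝ ((⊤ : ℕ∞) : WithTop ℕ∞) (mollify ρ f) :=
  ρ.hasCompactSupport_normed.contDiff_convolution_left _ ρ.contDiff_normed hf

lemma norm_mollify_le (ρ : ContDiffBump (0 : E3)) {f : E3 → F} {L : ℝ}
    (hL : ∀ᵐ x, ‖f x‖ ≤ L) (x : E3) : ‖mollify ρ f x‖ ≤ L := by
  have h1 : ∀ᵐ t, ‖ρ.normed volume t • f (x - t)‖ ≤ ρ.normed volume t * L := by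
    have := (Measure.measurePreserving_sub_left (volume : Measure E3) x).quasiMeasurePreserving.ae hL
    filter_upwards [this] with t ht
    rw [norm_smul, Real.norm_of_nonneg (ρ.nonneg_normed t)]
    exact mul_le_mul_of_nonneg_left ht (ρ.nonneg_normed t)
  rw [mollify_apply]
  refine (norm_integral_le_of_norm_le (ρ.integrable_normed.mul_const L) h1).trans ?_
  rw [integral_mul_const, ρ.integral_normed, one_mul]

lemma lipschitzWith_mollify (ρ : ContDiffBump (0 : E3)) {f : E3 → F} {L : ℝ≥0}
    (hf : LipschitzWith L f) : LipschitzWith L (mollify ρ f) := by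
  refine LipschitzWith.of_dist_le_mul fun x y => ?_
  have hi := hf.continuous.locallyIntegrable (μ := (volume : Measure E3))
  rw [dist_eq_norm, mollify_apply, mollify_apply,
    ← integral_sub (integrable_mollify ρ hi x) (integrable_mollify ρ hi y)]
  have h1 : ∀ᵐ t, ‖ρ.normed volume t • f (x - t) - ρ.normed volume t • f (y - t)‖
      ≤ ρ.normed volume t * (L * dist x y) := by
    refine Filter.Eventually.of_forall fun t => ?_
    rw [← smul_sub, norm_smul, Real.norm_of_nonneg (ρ.nonneg_normed t), ← dist_eq_norm]
    refine mul_le_mul_of_nonneg_left ((hf.dist_le_mul _ _).trans ?_) (ρ.nonneg_normed t)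
    rw [dist_sub_right]
  refine (norm_integral_le_of_norm_le (ρ.integrable_normed.mul_const _) h1).trans ?_
  rw [integral_mul_const, ρ.integral_normed, one_mul]

lemma normed_eq_zero_of_le (ρ : ContDiffBump (0 : E3)) {t : E3} (ht : ρ.rOut ≤ ‖t‖) :
    ρ.normed volume t = 0 := by
  by_contra h
  have : t ∈ Function.support (ρ.normed (volume : Measure E3)) := h
  rw [ρ.support_normed_eq, mem_ball_zero_iff] at this
  exact absurd this (not_lt.2 ht)

/-- Averaging respects affine maps while the support of the kernel stays where `f` is affine. The
first moment of the kernel only shifts the constant, so it need not be evaluated. -/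
lemma mollify_eq_affine [CompleteSpace F] (ρ : ContDiffBump (0 : E3)) {f : E3 → F} {x : E3}
    {R : ℝ} (c : F) (M : E3 →L[ℝ] F) (h : ∀ᵐ z, z ∈ Metric.ball x R → f z = c + M z) {y : E3}
    (hy : y ∈ Metric.ball x (R - ρ.rOut)) :
    mollify ρ f y = c + M y - M (∫ t, ρ.normed volume t • t) := by
  have hρ : Integrable (fun t : E3 => ρ.normed volume t • t) :=
    (ρ.continuous_normed.smul continuous_id).integrable_of_hasCompactSupport
      ρ.hasCompactSupport_normed.smul_right
  have e : ∀ᵐ t, ρ.normed volume t • f (y - t)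
      = ρ.normed volume t • (c + M y) - M (ρ.normed volume t • t) := by
    have := (Measure.measurePreserving_sub_left (volume : Measure E3) y).quasiMeasurePreserving.ae h
    filter_upwards [this] with t ht
    rcases le_or_gt ρ.rOut ‖t‖ with h1 | h1
    · simp [normed_eq_zero_of_le ρ h1]
    · rw [ht, map_sub, map_smul, ← smul_sub, add_sub_assoc]
      rw [Metric.mem_ball, dist_eq_norm] at hy ⊢
      calc ‖y - t - x‖ = ‖(y - x) - t‖ := by congr 1; abel
        _ ≤ ‖y - x‖ + ‖t‖ := norm_sub_le _ _
        _ < R := by linarith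
  rw [mollify_apply, integral_congr_ae e, integral_sub (ρ.integrable_normed.smul_const _)
    (M.integrable_comp hρ), integral_smul_const, ρ.integral_normed, one_smul,
    M.integral_comp_comm hρ]

lemma hasFDerivAt_mollify_of_affine [CompleteSpace F] (ρ : ContDiffBump (0 : E3)) {f : E3 → F}
    {x : E3} {R : ℝ} (c : F) (M : E3 →L[ℝ] F) (h : ∀ᵐ z, z ∈ Metric.ball x R → f z = c + M z)
    (hR : ρ.rOut < R) : HasFDerivAt (mollify ρ f) M x := by
  have h1 : HasFDerivAt (fun y => c + M y - M (∫ t, ρ.normed volume t • t)) M x :=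
    (M.hasFDerivAt.const_add c).sub_const _
  refine h1.congr_of_eventuallyEq ?_
  filter_upwards [Metric.ball_mem_nhds x (sub_pos.2 hR)] with y hy
  exact mollify_eq_affine ρ c M h hy

lemma dist_mollify_le [CompleteSpace F] (ρ : ContDiffBump (0 : E3)) {f : E3 → F} {L : ℝ≥0}
    (hf : LipschitzWith L f) (x : E3) : dist (mollify ρ f x) (f x) ≤ L * ρ.rOut := by
  refine ContDiffBump.dist_normed_convolution_le hf.continuous.aestronglyMeasurable fun y hy => ?_
  exact (hf.dist_le_mul _ _).trans (mul_le_mul_of_nonneg_left (Metric.mem_ball.1 hy).le L.2)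

lemma support_mollify_subset (ρ : ContDiffBump (0 : E3)) (f : E3 → F) :
    Function.support (mollify ρ f) ⊆ Metric.thickening ρ.rOut (Function.support f) := by
  refine (support_convolution_subset _).trans ?_
  rw [ρ.support_normed_eq, Set.add_subset_iff]
  intro t ht y hy
  rw [Metric.mem_thickening_iff]
  exact ⟨y, hy, by simpa using ht⟩

lemma curl_smul_const {g : E3 → ℝ} {x : E3} (hg : DifferentiableAt ℝ g x) (c : E3) :
    curl (fun t => g t • c) x = cross (gradient g x) c := by
  have h : ∀ i j, partialD (fun t => g t • c) i j x
      = fderiv ℝ g x (EuclideanSpace.single i 1) * c j := by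
    intro i j
    simp [partialD, fderiv_smul_const hg]
  have h2 : ∀ i, fderiv ℝ g x (EuclideanSpace.single i 1) = gradient g x i := by
    intro i
    rw [← inner_gradient_left (f := g), EuclideanSpace.inner_single_right]
    simp
  ext i
  fin_cases i <;> simp [curl, h, h2, cross, crossProduct]

lemma cross_cross (a b c : E3) : cross a (cross b c) = inner ℝ a c • b - inner ℝ a b • c := by
  ext i
  fin_cases i <;> simp [cross, crossProduct, PiLp.inner_apply, Fin.sum_univ_three] <;> ring

/-- `u` is curl-free on the whole space in the sense of distributions. -/
def IsCurlFree (u : E3 → E3) : Prop :=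
  ∀ ψ : E3 → E3, ContDiff ℝ ((⊤ : ℕ∞) : WithTop ℕ∞) ψ → HasCompactSupport ψ →
    ∫ x, inner ℝ (u x) (curl ψ x) = 0

/-- The derivative falls on the kernel, and the substitution `t ↦ x - t` leaves `u` itself tested
against a smooth field. -/
lemma inner_fderiv_mollify (ρ : ContDiffBump (0 : E3)) {u : E3 → E3}
    (hu : LocallyIntegrable u volume) (x v w : E3) :
    inner ℝ (fderiv ℝ (mollify ρ u) x v) w
      = ∫ t, inner ℝ (u t) (fderiv ℝ (ρ.normed volume) (x - t) v • w) ∧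
    Integrable (fun t => inner ℝ (u t) (fderiv ℝ (ρ.normed volume) (x - t) v • w)) := by
  have h1 := ρ.hasCompactSupport_normed.hasFDerivAt_convolution_left (𝕜 := ℝ)
    (ContinuousLinearMap.lsmul ℝ ℝ) (ρ.contDiff_normed (μ := volume) (n := 1)) hu x
  have hex : Integrable (fun t => ((ContinuousLinearMap.lsmul ℝ ℝ).precompL E3
      (fderiv ℝ (ρ.normed volume) t)) (u (x - t))) :=
    (ρ.hasCompactSupport_normed.fderiv ℝ).convolutionExists_left
      ((ContinuousLinearMap.lsmul ℝ ℝ : ℝ →L[ℝ] E3 →L[ℝ] E3).precompL E3)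
      ((ρ.contDiff_normed (μ := volume) (n := 1)).continuous_fderiv one_ne_zero) hu x
  have hex' := hex.comp_sub_left x
  let Λ : (E3 →L[ℝ] E3) →L[ℝ] ℝ :=
    (innerSL ℝ w).comp (ContinuousLinearMap.apply ℝ E3 v)
  have e : ∀ t, Λ (((ContinuousLinearMap.lsmul ℝ ℝ).precompL E3
      (fderiv ℝ (ρ.normed volume) (x - t))) (u (x - (x - t))))
      = inner ℝ (u t) (fderiv ℝ (ρ.normed volume) (x - t) v • w) := by
    intro t
    simp [Λ, inner_smul_right, real_inner_comm]
  constructor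
  · have h2 : fderiv ℝ (mollify ρ u) x = ∫ t, ((ContinuousLinearMap.lsmul ℝ ℝ).precompL E3
      (fderiv ℝ (ρ.normed volume) (x - t))) (u (x - (x - t))) := by
      rw [integral_sub_left_eq_self (fun t => ((ContinuousLinearMap.lsmul ℝ ℝ).precompL E3
        (fderiv ℝ (ρ.normed volume) t)) (u (x - t))) volume x]
      exact h1.fderiv
    simp_rw [← e]
    rw [Λ.integral_comp_comm hex', ← h2, real_inner_comm]
    rfl
  · simp_rw [← e]
    exact Λ.integrable_comp hex'

/-- The test field is `ρ(x - t) (v × w)`. By the identity for `a × (b × c)` its curl in `t` is `(∂_v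
ρ) w - (∂_w ρ) v` evaluated at `x - t`, exactly the antisymmetric part of the derivative of the
mollified field. -/
lemma fderiv_mollify_symm (ρ : ContDiffBump (0 : E3)) {u : E3 → E3}
    (hu : LocallyIntegrable u volume) (hc : IsCurlFree u) (x v w : E3) :
    inner ℝ (fderiv ℝ (mollify ρ u) x v) w = inner ℝ (fderiv ℝ (mollify ρ u) x w) v := by
  obtain ⟨e1, i1⟩ := inner_fderiv_mollify ρ hu x v w
  obtain ⟨e2, i2⟩ := inner_fderiv_mollify ρ hu x w v
  have hρ := ρ.contDiff_normed (μ := (volume : Measure E3)) (n := ⊤)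
  have hsub : ContDiff ℝ ((⊤ : ℕ∞) : WithTop ℕ∞) (fun t : E3 => x - t) :=
    contDiff_const.sub contDiff_id
  have hcomp := hρ.comp hsub
  have hcs : HasCompactSupport (fun t : E3 => ρ.normed volume (x - t)) :=
    ρ.hasCompactSupport_normed.comp_homeomorph (Homeomorph.subLeft x)
  have h0 := hc (fun t => ρ.normed volume (x - t) • cross v w)
    (hcomp.smul contDiff_const) hcs.smul_right
  rw [← sub_eq_zero, e1, e2, ← integral_sub i1 i2, ← h0]
  refine integral_congr_ae (Filter.Eventually.of_forall fun t => ?_)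
  have hd : DifferentiableAt ℝ (fun t : E3 => ρ.normed volume (x - t)) t :=
    (hcomp.differentiable (by simp)) t
  have hf : fderiv ℝ (fun t : E3 => ρ.normed volume (x - t)) t
      = - fderiv ℝ (ρ.normed volume) (x - t) := by
    have h1 : HasFDerivAt (ρ.normed (volume : Measure E3))
        (fderiv ℝ (ρ.normed volume) (x - t)) (x - t) :=
      ((hρ.differentiable (by simp)) (x - t)).hasFDerivAt
    have h2 := h1.comp t ((hasFDerivAt_id t).const_sub x)
    refine h2.fderiv.trans ?_
    ext z
    simp
  have hg : ∀ z, inner ℝ (gradient (fun t : E3 => ρ.normed volume (x - t)) t) z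
      = - fderiv ℝ (ρ.normed volume) (x - t) z := by
    intro z
    rw [inner_gradient_left, hf]
    rfl
  simp only
  rw [curl_smul_const hd, cross_cross, hg, hg, ← inner_sub_right]
  congr 1
  simp only [neg_smul]
  abel

end Mollification

/-! ### Lipschitz potentials of bounded curl-free fields. -/

section Potential

/-- A sequence of smooth bump functions at the origin with radii tending to zero. -/
def bump (n : ℕ) : ContDiffBump (0 : E3) where
  rIn := 1 / (2 * ((n : ℝ) + 1))
  rOut := 1 / ((n : ℝ) + 1)
  rIn_pos := by positivity
  rIn_lt_rOut := by
    apply one_div_lt_one_div_of_lt <;> linarith [(Nat.cast_nonneg n : (0 : ℝ) ≤ n)]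

lemma tendsto_bump_rOut : Filter.Tendsto (fun n => (bump n).rOut) Filter.atTop (𝓝 0) :=
  tendsto_one_div_add_atTop_nhds_zero_nat

/-- Poincaré lemma on the convex set `ℝ³`. The normalization at the origin makes a family of
potentials with a common Lipschitz constant pointwise bounded. -/
lemma exists_potential_mollify (ρ : ContDiffBump (0 : E3)) {u : E3 → E3}
    (hu : LocallyIntegrable u volume) (hc : IsCurlFree u) :
    ∃ f : E3 → ℝ, f 0 = 0 ∧ ∀ a, HasFDerivAt f (innerSL ℝ (mollify ρ u a)) a := by
  have hd : Differentiable ℝ (mollify ρ u) := (contDiff_mollify ρ hu).differentiable (by simp)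
  have hω : ∀ a, HasFDerivAt (fun a => innerSL ℝ (mollify ρ u a))
      ((innerSL ℝ).comp (fderiv ℝ (mollify ρ u) a)) a := fun a =>
    ((innerSL ℝ).hasFDerivAt.comp a (hd a).hasFDerivAt :)
  obtain ⟨f, hf⟩ := convex_univ.exists_forall_hasFDerivAt_of_fderiv_symmetric isOpen_univ
    (ω := fun a => innerSL ℝ (mollify ρ u a))
    (fun a _ => (hω a).differentiableAt.differentiableWithinAt) (fun a _ v w => by
      rw [(hω a).fderiv]
      exact fderiv_mollify_symm ρ hu hc a v w)
  exact ⟨fun x => f x - f 0, sub_self _, fun a => (hf a (Set.mem_univ a)).sub_const _⟩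

lemma eq_add_inner_of_hasFDerivAt {f : E3 → ℝ} {v : E3 → E3}
    (hf : ∀ a, HasFDerivAt f (innerSL ℝ (v a)) a) {S : Set E3} (hS : Convex ℝ S) {a : E3}
    (hv : ∀ z ∈ S, v z = a) {x y : E3} (hx : x ∈ S) (hy : y ∈ S) :
    f y = f x + inner ℝ a (y - x) := by
  -- Mean value inequality with constant `0` for `f - ⟨a, ·⟩`, whose derivative vanishes on `S`.
  have h := hS.norm_image_sub_le_of_norm_hasFDerivWithin_le (𝕜 := ℝ) (C := 0)
    (f := fun z => f z - innerSL ℝ a z) (f' := fun z => innerSL ℝ (v z) - innerSL ℝ a)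
    (fun z _ => ((hf z).sub (innerSL ℝ a).hasFDerivAt).hasFDerivWithinAt)
    (fun z hz => by simp [hv z hz]) hx hy
  rw [zero_mul, norm_le_zero_iff] at h
  simp only [innerSL_apply_apply] at h
  rw [inner_sub_right]
  linarith

/-- A bounded curl-free field on the whole space has a Lipschitz potential, which is affine
wherever the field is constant. -/
theorem exists_lipschitz_potential {u : E3 → E3} (hu : LocallyIntegrable u volume) {L : ℝ≥0}
    (hL : ∀ᵐ x, ‖u x‖ ≤ L) (hc : IsCurlFree u) :
    ∃ s : E3 → ℝ, LipschitzWith L s ∧ ∀ (x : E3) (R : ℝ) (a : E3),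
      (∀ᵐ z, z ∈ Metric.ball x R → u z = a) →
        ∀ y ∈ Metric.ball x R, s y = s x + inner ℝ a (y - x) := by
  choose f hf0 hf using fun n => exists_potential_mollify (bump n) hu hc
  have hlip : ∀ n, LipschitzWith L (f n) := fun n =>
    lipschitzWith_of_nnnorm_fderiv_le (𝕜 := ℝ) (fun x => (hf n x).differentiableAt) fun x => by
      rw [(hf n x).fderiv, ← NNReal.coe_le_coe, coe_nnnorm, innerSL_apply_norm]
      exact norm_mollify_le _ hL x
  -- A limit along a free ultrafilter exists at every point simultaneously, so no diagonal
  -- subsequence is needed.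
  have hlim : ∀ x, ∃ l, Filter.Tendsto (fun n => f n x) (Filter.hyperfilter ℕ : Filter ℕ) (𝓝 l) := by
    intro x
    obtain ⟨l, -, hl⟩ := (isCompact_closedBall (0 : ℝ) (L * dist x 0)).ultrafilter_le_nhds
      ((Filter.hyperfilter ℕ).map fun n => f n x) (by
        rw [Filter.le_principal_iff]
        refine Filter.eventually_map.2 (Filter.Eventually.of_forall fun n => ?_)
        have := (hlip n).dist_le_mul x 0
        rwa [hf0, ← Metric.mem_closedBall] at this)
    exact ⟨l, hl⟩
  choose s hs using hlim
  refine ⟨s, LipschitzWith.of_dist_le_mul fun x y => ?_, fun x R a ha y hy => ?_⟩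
  · exact le_of_tendsto ((hs x).dist (hs y))
      (Filter.Eventually.of_forall fun n => (hlip n).dist_le_mul x y)
  -- Once the bump radius is below this gap, `x` and `y` both lie in the shrunken ball on which the
  -- mollified field equals `a`.
  · have hR : 0 < R - dist y x := sub_pos.2 (Metric.mem_ball.1 hy)
    have hev : ∀ᶠ n in (Filter.hyperfilter ℕ : Filter ℕ), f n y = f n x + inner ℝ a (y - x) := by
      refine Filter.Eventually.filter_mono Nat.hyperfilter_le_atTop ?_
      filter_upwards [tendsto_bump_rOut.eventually (gt_mem_nhds hR)] with n hn
      refine eq_add_inner_of_hasFDerivAt (hf n) (convex_ball x (R - (bump n).rOut)) (fun z hz => ?_)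
        ?_ ?_
      · have := mollify_eq_affine (bump n) a 0 (by simpa using ha) hz
        simpa using this
      · exact Metric.mem_ball_self (by linarith [dist_nonneg (x := y) (y := x)])
      · rw [Metric.mem_ball]
        linarith
    exact tendsto_nhds_unique ((hs y).congr' hev) ((hs x).add_const _)

end Potential

/-! ### Lipschitz boundaries, the exterior, and the cells of the mesh. -/

section Geometry

variable {Ω : Opens E3}

/-- Near a boundary point, a Lipschitz domain is the positivity set of a Lipschitz function which
decreases at unit speed in a fixed direction. -/
lemma IsBoundedLipschitzDomain.exists_chart (hΩ : IsBoundedLipschitzDomain Ω) {x : E3}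
    (hx : x ∈ frontier (Ω : Set E3)) :
    ∃ (G : E3 → ℝ) (d : E3) (M : ℝ≥0), LipschitzWith M G ∧
      (∀ y t, G (y + t • d) = G y - t) ∧ ∀ᶠ y in 𝓝 x, (y ∈ Ω ↔ 0 < G y) := by
  obtain ⟨e, K, γ, hγ, h⟩ := hΩ.lipschitz x hx
  have hcoord : ∀ (z : E3) (i : Fin 3), |z i| ≤ ‖z‖ := fun z i => PiLp.norm_apply_le z i
  have hp : ∀ y z : E3, dist (!₂[y 0, y 1] : EuclideanSpace ℝ (Fin 2)) !₂[z 0, z 1] ≤ dist y z := by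
    intro y z
    rw [EuclideanSpace.dist_eq, EuclideanSpace.dist_eq]
    refine Real.sqrt_le_sqrt ?_
    simp only [Fin.sum_univ_two, Fin.sum_univ_three]
    simp
  refine ⟨fun y => e y 2 - γ !₂[e y 0, e y 1], e.symm (EuclideanSpace.single 2 (-1)), 1 + K,
    LipschitzWith.of_dist_le_mul fun y z => ?_, fun y t => ?_, ?_⟩
  · have h1 : |e y 2 - e z 2| ≤ dist y z := by
      rw [← e.dist_map y z, dist_eq_norm]
      exact hcoord (e y - e z) 2
    have h2 : |γ !₂[e y 0, e y 1] - γ !₂[e z 0, e z 1]| ≤ K * dist y z := by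
      refine (hγ.dist_le_mul _ _).trans (mul_le_mul_of_nonneg_left ?_ K.2)
      rw [← e.dist_map y z]
      exact hp _ _
    rw [Real.dist_eq, NNReal.coe_add, NNReal.coe_one, add_mul, one_mul]
    rw [abs_le] at h1 h2 ⊢
    constructor <;> linarith [h1.1, h1.2, h2.1, h2.2]
  · simp
    ring
  · filter_upwards [h] with y hy
    rw [hy, sub_pos]

/-- Inside the ball the open set `{G < 0}` misses `Ω`, hence also its closure. -/
lemma IsBoundedLipschitzDomain.exists_chart_ball (hΩ : IsBoundedLipschitzDomain Ω) {x : E3}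
    (hx : x ∈ frontier (Ω : Set E3)) :
    ∃ (G : E3 → ℝ) (d : E3) (M : ℝ≥0) (r : ℝ), LipschitzWith M G ∧
      (∀ y t, G (y + t • d) = G y - t) ∧ 0 < r ∧
      (∀ y ∈ Metric.ball x r, y ∉ Ω → G y ≤ 0) ∧
      ∀ y ∈ Metric.ball x r, G y < 0 → y ∈ (closure (Ω : Set E3))ᶜ := by
  obtain ⟨G, d, M, hG, hd, h⟩ := hΩ.exists_chart hx
  obtain ⟨r, hr, h⟩ := Metric.eventually_nhds_iff_ball.1 h
  refine ⟨G, d, M, r, hG, hd, hr, fun y hy hyΩ => not_lt.1 fun h0 => hyΩ ((h y hy).2 h0),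
    fun y hy hy0 hc => ?_⟩
  obtain ⟨z, ⟨hz, hz0⟩, hzΩ⟩ := mem_closure_iff.1 hc (Metric.ball x r ∩ {z | G z < 0})
    (Metric.isOpen_ball.inter (isOpen_lt hG.continuous continuous_const)) ⟨hy, hy0⟩
  exact absurd ((h z hz).1 hzΩ) (not_lt.2 (le_of_lt hz0))

/-- A Lipschitz domain has no slits: from a boundary point, any short move along `d` enters the
exterior. This is what places open cells inside `Ω`, since the mesh is only known to cover the
closure. -/
lemma IsBoundedLipschitzDomain.interior_closure_subset (hΩ : IsBoundedLipschitzDomain Ω) :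
    interior (closure (Ω : Set E3)) ⊆ Ω := by
  intro x hx
  by_contra hxΩ
  have hxf : x ∈ frontier (Ω : Set E3) := by
    rw [frontier, Ω.isOpen.interior_eq]
    exact ⟨interior_subset hx, hxΩ⟩
  obtain ⟨G, d, M, r, hG, hd, hr, h1, h2⟩ := hΩ.exists_chart_ball hxf
  have hc : Filter.Tendsto (fun t : ℝ => x + t • d) (𝓝[>] 0) (𝓝 x) := by
    have : Continuous fun t : ℝ => x + t • d := by fun_prop
    simpa using (this.tendsto 0).mono_left nhdsWithin_le_nhds
  obtain ⟨t, ht, ht1, ht2⟩ := ((eventually_mem_nhdsWithin (a := (0 : ℝ)) (s := Set.Ioi 0)).and ((hc.eventually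
    (isOpen_interior.mem_nhds hx)).and (hc.eventually (Metric.ball_mem_nhds x hr)))).exists
  refine h2 _ ht2 ?_ (interior_subset ht1)
  have := h1 x (Metric.mem_ball_self hr) hxΩ
  rw [hd]
  linarith [Set.mem_Ioi.1 ht]

lemma eq_of_isPreconnected {X Y : Type*} [TopologicalSpace X] {s : X → Y} {T : Set X}
    (hT : IsPreconnected T) (h : ∀ y ∈ T, ∀ᶠ z in 𝓝 y, z ∈ T → s z = s y) {a b : X}
    (ha : a ∈ T) (hb : b ∈ T) : s a = s b := by
  have : PreconnectedSpace T := isPreconnected_iff_preconnectedSpace.1 hT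
  have hl : IsLocallyConstant (fun z : T => s z) := by
    rw [IsLocallyConstant.iff_eventually_eq]
    intro y
    have := continuous_subtype_val.continuousAt.eventually (h y y.2)
    filter_upwards [this] with z hz using hz z.2
  exact hl.apply_eq_of_preconnectedSpace ⟨a, ha⟩ ⟨b, hb⟩

/-- Every point of the complement near `x` is joined to `x` by a move along `d` into the exterior, a
move across a translated ball contained in the exterior, and a move back. -/
lemma eventually_eq_near_frontier (hΩ : IsBoundedLipschitzDomain Ω) {s : E3 → ℝ}
    (hs : Continuous s) (h : ∀ y ∈ (closure (Ω : Set E3))ᶜ, ∀ᶠ z in 𝓝 y, s z = s y) {x : E3}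
    (hx : x ∈ frontier (Ω : Set E3)) : ∀ᶠ y in 𝓝 x, y ∉ Ω → s y = s x := by
  obtain ⟨G, d, M, r, hG, hd, hr, h1, h2⟩ := hΩ.exists_chart_ball hx
  have hxΩ : x ∉ Ω := by
    rw [frontier, Ω.isOpen.interior_eq] at hx
    exact hx.2
  have hconst : ∀ T : Set E3, IsPreconnected T → T ⊆ (closure (Ω : Set E3))ᶜ →
      ∀ a ∈ T, ∀ b ∈ T, s a = s b := fun T hT hTe a ha b hb =>
    eq_of_isPreconnected hT (fun y hy => (h y (hTe hy)).mono fun z hz _ => hz) ha hb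
  -- The translation by `t • d` must be shorter than `r / 2`; the `+ 1` makes the denominator
  -- visibly positive.
  set t : ℝ := r / (2 * (‖d‖ + 1)) with ht
  have ht0 : 0 < t := by positivity
  have htd : t * ‖d‖ < r / 2 := by
    rw [ht, div_mul_eq_mul_div, div_lt_div_iff₀ (by positivity) (by positivity)]
    nlinarith [norm_nonneg d]
  -- On the `δ`-ball `G` exceeds `G x ≤ 0` by at most `M * δ < t`, so translating by `t • d` makes
  -- it negative throughout.
  set δ : ℝ := min (r / 2) (t / (M + 1)) with hδ
  have hδ0 : 0 < δ := by positivity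
  have hMδ : M * δ < t := by
    have h3 : δ * (M + 1) ≤ t := (le_div_iff₀ (by positivity)).1 (min_le_right _ _)
    linarith
  have hball : ∀ y ∈ Metric.ball x δ, ∀ τ, 0 ≤ τ → τ ≤ t → y + τ • d ∈ Metric.ball x r := by
    intro y hy τ hτ hτt
    rw [Metric.mem_ball, dist_eq_norm] at hy ⊢
    calc ‖y + τ • d - x‖ = ‖(y - x) + τ • d‖ := by congr 1; abel
      _ ≤ ‖y - x‖ + τ * ‖d‖ := (norm_add_le _ _).trans_eq (by
          rw [norm_smul, Real.norm_of_nonneg hτ])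
      _ < δ + r / 2 := by
          have := mul_le_mul_of_nonneg_right hτt (norm_nonneg d)
          linarith
      _ ≤ r := by linarith [min_le_left (r / 2) (t / (M + 1))]
  have hvert : ∀ y ∈ Metric.ball x δ, y ∉ Ω → s y = s (y + t • d) := by
    intro y hy hyΩ
    have hGy : G y ≤ 0 := h1 y (by simpa using hball y hy 0 le_rfl ht0.le) hyΩ
    have hc : Continuous fun τ : ℝ => y + τ • d := by fun_prop
    have hT := hconst ((fun τ : ℝ => y + τ • d) '' Set.Ioc 0 t)
      (isPreconnected_Ioc.image _ hc.continuousOn) (by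
        rintro _ ⟨τ, hτ, rfl⟩
        refine h2 _ (hball y hy τ hτ.1.le hτ.2) ?_
        simp only [hd]
        linarith [hτ.1])
    -- The segment used above omits `τ = 0`, where `y` may lie on the boundary; continuity of `s`
    -- recovers that endpoint.
    have hlim : Filter.Tendsto (fun τ : ℝ => s (y + τ • d)) (𝓝[>] 0) (𝓝 (s y)) := by
      simpa [Function.comp_def] using ((hs.comp hc).tendsto 0).mono_left nhdsWithin_le_nhds
    refine tendsto_nhds_unique hlim (tendsto_const_nhds.congr' ?_)
    filter_upwards [Ioc_mem_nhdsGT ht0] with τ hτ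
    exact hT _ ⟨t, ⟨ht0, le_rfl⟩, rfl⟩ _ ⟨τ, hτ, rfl⟩
  have hshift : ∀ y ∈ Metric.ball x δ, s (y + t • d) = s (x + t • d) := by
    intro y hy
    refine hconst ((fun z => z + t • d) '' Metric.ball x δ)
      ((convex_ball x δ).isPreconnected.image _ (by fun_prop)) ?_ _ ⟨y, hy, rfl⟩ _
      ⟨x, Metric.mem_ball_self hδ0, rfl⟩
    rintro _ ⟨z, hz, rfl⟩
    refine h2 _ (hball z hz t ht0.le le_rfl) ?_
    simp only [hd]
    have h4 : G z - G x ≤ M * δ := (le_abs_self _).trans ((hG.dist_le_mul z x).trans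
      (mul_le_mul_of_nonneg_left (Metric.mem_ball.1 hz).le M.2))
    linarith [h1 x (Metric.mem_ball_self hr) hxΩ]
  filter_upwards [Metric.ball_mem_nhds x hδ0] with y hy hyΩ
  rw [hvert y hy hyΩ, hshift y hy, ← hvert x (Metric.mem_ball_self hδ0) hxΩ]

/-- If the boundary of a Lipschitz domain is connected, then a continuous function which is locally
constant in the exterior is constant on the complement. -/
lemma exists_eq_const_compl (hΩ : IsBoundedLipschitzDomain Ω)
    (hfr : IsConnected (frontier (Ω : Set E3))) {s : E3 → ℝ} (hs : Continuous s)
    (h : ∀ y ∈ (closure (Ω : Set E3))ᶜ, ∀ᶠ z in 𝓝 y, s z = s y) :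
    ∃ c, ∀ y ∉ Ω, s y = c := by
  have hnear := fun x hx => eventually_eq_near_frontier (x := x) hΩ hs h hx
  have hfrΩ : ∀ y ∈ frontier (Ω : Set E3), y ∉ Ω := by
    intro y hy
    rw [frontier, Ω.isOpen.interior_eq] at hy
    exact hy.2
  obtain ⟨x₀, hx₀⟩ := hfr.nonempty
  have hfc : ∀ x ∈ frontier (Ω : Set E3), s x = s x₀ := fun x hx =>
    eq_of_isPreconnected hfr.isPreconnected
      (fun y hy => (hnear y hy).mono fun z hz hz' => hz (hfrΩ z hz')) hx hx₀
  -- `D` is clopen in all of `ℝ³` and misses the nonempty `Ω`, hence is empty. This bypasses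
  -- connectedness of the exterior.
  set D : Set E3 := {y | y ∉ closure (Ω : Set E3) ∧ s y ≠ s x₀} with hD
  have hDo : IsOpen D :=
    isClosed_closure.isOpen_compl.inter (isOpen_ne_fun hs continuous_const)
  have hDc : IsClosed D := by
    refine isClosed_of_closure_subset fun y hy => ?_
    by_cases hyc : y ∈ closure (Ω : Set E3)
    · exfalso
      have hyΩ : y ∉ Ω := by
        intro hyΩ
        obtain ⟨z, hz, hzD⟩ := mem_closure_iff.1 hy Ω Ω.isOpen hyΩ
        exact hzD.1 (subset_closure hz)
      have hyf : y ∈ frontier (Ω : Set E3) := by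
        rw [frontier, Ω.isOpen.interior_eq]
        exact ⟨hyc, hyΩ⟩
      obtain ⟨z, hzD, hz⟩ := ((mem_closure_iff_frequently.1 hy).and_eventually (hnear y hyf)).exists
      exact hzD.2 ((hz fun h' => hzD.1 (subset_closure h')).trans (hfc y hyf))
    · obtain ⟨z, hzD, hz⟩ := ((mem_closure_iff_frequently.1 hy).and_eventually (h y hyc)).exists
      exact ⟨hyc, hz ▸ hzD.2⟩
  have hDe : D = ∅ := by
    rcases isClopen_iff.1 ⟨hDc, hDo⟩ with h' | h'
    · exact h'
    · obtain ⟨z, hz⟩ := hΩ.connected.nonempty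
      have : z ∈ D := h' ▸ Set.mem_univ z
      exact absurd (subset_closure hz) this.1
  refine ⟨s x₀, fun y hy => ?_⟩
  by_cases hyc : y ∈ closure (Ω : Set E3)
  · refine hfc y ?_
    rw [frontier, Ω.isOpen.interior_eq]
    exact ⟨hyc, hy⟩
  · by_contra hne
    have : y ∈ D := ⟨hyc, hne⟩
    rw [hDe] at this
    exact this

variable {K : Geometry.SimplicialComplex ℝ E3}

lemma IsTetMesh.interior_subset (hK : IsTetMesh Ω K) (hΩ : IsBoundedLipschitzDomain Ω)
    {T : Finset E3} (hT : IsCell K T) : interior (convexHull ℝ (T : Set E3)) ⊆ Ω := by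
  refine (interior_mono ?_).trans hΩ.interior_closure_subset
  rw [← hK.space_eq]
  exact K.convexHull_subset_space hT.1

/-- Frontiers of convex sets are null, and every face lies in a maximal one, which is a tetrahedron
by purity. -/
lemma IsTetMesh.ae_mem_interior (hK : IsTetMesh Ω K) :
    ∀ᵐ x, x ∈ Ω → ∃ T, IsCell K T ∧ x ∈ interior (convexHull ℝ (T : Set E3)) := by
  have h1 : ∀ᵐ x, ∀ T ∈ K.faces, x ∉ frontier (convexHull ℝ (T : Set E3)) := by
    rw [ae_ball_iff hK.finite.countable]
    intro T _
    exact measure_eq_zero_iff_ae_notMem.1 ((convex_convexHull ℝ (T : Set E3)).addHaar_frontier volume)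
  filter_upwards [h1] with x hx hxΩ
  have hxs : x ∈ K.space := by
    rw [hK.space_eq]
    exact subset_closure hxΩ
  obtain ⟨S, hS, hxS⟩ := Geometry.SimplicialComplex.mem_space_iff.1 hxs
  obtain ⟨T, hST, hT⟩ := hK.finite.exists_le_maximal hS
  have hTf : T ∈ K.facets := ⟨hT.1, fun t ht htT => hT.eq_of_le ht htT⟩
  refine ⟨T, ⟨hT.1, hK.pure T hTf⟩, ?_⟩
  have hxT : x ∈ convexHull ℝ (T : Set E3) := convexHull_mono (Finset.coe_subset.2 hST) hxS
  by_contra hxi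
  refine hx T hT.1 ⟨subset_closure hxT, hxi⟩

end Geometry

/-! ### Integration by parts and uniqueness of the weak curl. -/

section WeakDerivatives

variable {Ω : Opens E3}

lemma fderiv_eq_zero_of_notMem_tsupport {F : Type*} [NormedAddCommGroup F] [NormedSpace ℝ F]
    {f : E3 → F} {x : E3} (hx : x ∉ tsupport f) : fderiv ℝ f x = 0 := by
  by_contra h
  exact hx (support_fderiv_subset ℝ h)

lemma partialD_eq_zero {f : E3 → E3} {x : E3} (hx : x ∉ tsupport f) (i j : Fin 3) :
    partialD f i j x = 0 := by
  simp [partialD, fderiv_eq_zero_of_notMem_tsupport hx]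

lemma curl_eq_zero {f : E3 → E3} {x : E3} (hx : x ∉ tsupport f) : curl f x = 0 := by
  ext i
  fin_cases i <;> simp [curl, partialD_eq_zero hx]

lemma gradient_eq_zero {f : E3 → ℝ} {x : E3} (hx : x ∉ tsupport f) : gradient f x = 0 := by
  simp [gradient, fderiv_eq_zero_of_notMem_tsupport hx]

lemma divergence_eq_zero {f : E3 → E3} {x : E3} (hx : x ∉ tsupport f) : divergence f x = 0 := by
  simp [divergence, partialD_eq_zero hx]

lemma hasCompactSupport_of_tsupport {F G : Type*} [Zero F] [Zero G]
    {f : E3 → F} {g : E3 → G} (hf : HasCompactSupport f) (h : ∀ x ∉ tsupport f, g x = 0) :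
    HasCompactSupport g :=
  hf.mono' fun x hx => by
    by_contra h'
    exact hx (h x h')

lemma integral_partialD {f g : E3 → E3} (hf : ContDiff ℝ 1 f) (hg : ContDiff ℝ 1 g)
    (hfc : HasCompactSupport f) (i a b : Fin 3) :
    ∫ x, f x a * partialD g i b x = -∫ x, partialD f i a x * g x b ∧
    Integrable (fun x => f x a * partialD g i b x) ∧
    Integrable (fun x => partialD f i a x * g x b) := by
  have hc : ∀ {h : E3 → E3} (hh : ContDiff ℝ 1 h) (j : Fin 3) (x v : E3),
      fderiv ℝ (fun x => h x j) x v = fderiv ℝ h x v j := by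
    intro h hh j x v
    have h1 := (EuclideanSpace.proj (𝕜 := ℝ) j : E3 →L[ℝ] ℝ).hasFDerivAt.comp x
      (hh.differentiable one_ne_zero x).hasFDerivAt
    have h2 := h1.fderiv
    exact congrArg (fun L : E3 →L[ℝ] ℝ => L v) h2
  have hf1 : Continuous fun x => f x a := by
    have := hf.continuous
    fun_prop
  have hg1 : Continuous fun x => g x b := by
    have := hg.continuous
    fun_prop
  have hz : ∀ x ∉ tsupport f, f x a = 0 := fun x hx => by simp [image_eq_zero_of_notMem_tsupport hx]
  have i1 : Integrable (fun x => f x a * partialD g i b x) :=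
    (hf1.mul (continuous_partialD hg i b)).integrable_of_hasCompactSupport
      (hasCompactSupport_of_tsupport hfc fun x hx => by simp [hz x hx])
  have i2 : Integrable (fun x => partialD f i a x * g x b) :=
    ((continuous_partialD hf i a).mul hg1).integrable_of_hasCompactSupport
      (hasCompactSupport_of_tsupport hfc fun x hx => by simp [partialD_eq_zero hx])
  have i3 : Integrable (fun x => f x a * g x b) :=
    (hf1.mul hg1).integrable_of_hasCompactSupport
      (hasCompactSupport_of_tsupport hfc fun x hx => by simp [hz x hx])
  refine ⟨?_, i1, i2⟩
  have hfd : Differentiable ℝ fun x => f x a := by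
    have := hf.differentiable one_ne_zero
    fun_prop
  have hgd : Differentiable ℝ fun x => g x b := by
    have := hg.differentiable one_ne_zero
    fun_prop
  have := integral_mul_fderiv_eq_neg_fderiv_mul_of_integrable (μ := (volume : Measure E3))
    (f := fun x => f x a) (g := fun x => g x b) (v := EuclideanSpace.single i (1 : ℝ))
    (by simpa only [hc hf, partialD] using i2) (by simpa only [hc hg, partialD] using i1) i3
    (fun x _ => hfd x) (fun x _ => hgd x)
  simpa only [hc hf, hc hg, partialD] using this

lemma integral_inner_curl {f g : E3 → E3} (hf : ContDiff ℝ 1 f) (hg : ContDiff ℝ 1 g)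
    (hfc : HasCompactSupport f) :
    ∫ x, inner ℝ (f x) (curl g x) = ∫ x, inner ℝ (curl f x) (g x) := by
  have h := fun i a b => (integral_partialD hf hg hfc i a b).1
  have h1 := fun i a b => (integral_partialD hf hg hfc i a b).2.1
  have h2 := fun i a b => (integral_partialD hf hg hfc i a b).2.2
  have e1 : ∀ x, inner ℝ (f x) (curl g x)
      = (f x 0 * partialD g 1 2 x - f x 0 * partialD g 2 1 x)
        + (f x 1 * partialD g 2 0 x - f x 1 * partialD g 0 2 x)
        + (f x 2 * partialD g 0 1 x - f x 2 * partialD g 1 0 x) := by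
    intro x
    simp [PiLp.inner_apply, Fin.sum_univ_three, curl]
    ring
  have e2 : ∀ x, inner ℝ (curl f x) (g x)
      = (partialD f 1 2 x * g x 0 - partialD f 2 1 x * g x 0)
        + (partialD f 2 0 x * g x 1 - partialD f 0 2 x * g x 1)
        + (partialD f 0 1 x * g x 2 - partialD f 1 0 x * g x 2) := by
    intro x
    simp [PiLp.inner_apply, Fin.sum_univ_three, curl]
    ring
  simp_rw [e1, e2]
  have d1 := fun i a b i' a' b' => (h1 i a b).sub (h1 i' a' b')
  have d2 := fun i a b i' a' b' => (h2 i a b).sub (h2 i' a' b')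
  simp only [Pi.sub_def] at d1 d2
  have s1 := fun i a b i' a' b' j c d j' c' d' => (d1 i a b i' a' b').add (d1 j c d j' c' d')
  have s2 := fun i a b i' a' b' j c d j' c' d' => (d2 i a b i' a' b').add (d2 j c d j' c' d')
  simp only [Pi.add_def] at s1 s2
  rw [integral_add (s1 _ _ _ _ _ _ _ _ _ _ _ _) (d1 _ _ _ _ _ _),
    integral_add (d1 _ _ _ _ _ _) (d1 _ _ _ _ _ _),
    integral_add (s2 _ _ _ _ _ _ _ _ _ _ _ _) (d2 _ _ _ _ _ _),
    integral_add (d2 _ _ _ _ _ _) (d2 _ _ _ _ _ _)]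
  simp only [integral_sub (h1 _ _ _) (h1 _ _ _), integral_sub (h2 _ _ _) (h2 _ _ _), h]
  ring

lemma integral_mul_divergence {f : E3 → ℝ} {g : E3 → E3} (hf : ContDiff ℝ 1 f)
    (hg : ContDiff ℝ 1 g) (hfc : HasCompactSupport f) :
    ∫ x, f x * divergence g x = -∫ x, inner ℝ (gradient f x) (g x) := by
  -- The scalar `f` is encoded as a component of a vector field, to reuse the integration by parts
  -- for components.
  set F : E3 → E3 := fun x => f x • EuclideanSpace.single 0 1 with hF
  have hFd : ContDiff ℝ 1 F := hf.smul contDiff_const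
  have hFc : HasCompactSupport F := hfc.smul_right
  have e0 : ∀ x, F x 0 = f x := fun x => by simp [hF]
  have e3 : ∀ i x, partialD F i 0 x = gradient f x i := by
    intro i x
    have hd := hf.differentiable one_ne_zero x
    have h3 := inner_gradient_left (f := f) (x := x) (y := EuclideanSpace.single i (1 : ℝ))
    rw [EuclideanSpace.inner_single_right] at h3
    simp [partialD, hF, fderiv_smul_const hd, ← h3]
  have h := fun i => integral_partialD hFd hg hFc i 0 i
  simp only [e0, e3] at h
  have e1 : ∀ x, f x * divergence g x = ∑ i, f x * partialD g i i x := fun x => by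
    rw [divergence, Finset.mul_sum]
  have e2 : ∀ x, inner ℝ (gradient f x) (g x) = ∑ i, gradient f x i * g x i := fun x => by
    rw [PiLp.inner_apply]
    exact Finset.sum_congr rfl fun i _ => mul_comm _ _
  simp_rw [e1, e2]
  rw [integral_finsetSum _ fun i _ => (h i).2.1, integral_finsetSum _ fun i _ => (h i).2.2,
    ← Finset.sum_neg_distrib]
  exact Finset.sum_congr rfl fun i _ => (h i).1

lemma tendsto_integral_inner {F : Type*} [NormedAddCommGroup F] [InnerProductSpace ℝ F]
    {μ : Measure E3} {f : ℕ → E3 → F} {u : Lp F 2 μ} {g : E3 → F} (hf : ∀ n, MemLp (f n) 2 μ)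
    (hg : MemLp g 2 μ)
    (hfu : Filter.Tendsto (fun n => eLpNorm (fun x => f n x - u x) 2 μ) Filter.atTop (𝓝 0)) :
    Filter.Tendsto (fun n => ∫ x, inner ℝ (f n x) (g x) ∂μ) Filter.atTop
      (𝓝 (∫ x, inner ℝ (u x) (g x) ∂μ)) := by
  have h1 : Filter.Tendsto (fun n => (hf n).toLp (f n)) Filter.atTop (𝓝 u) := by
    rw [Lp.tendsto_Lp_iff_tendsto_eLpNorm']
    refine hfu.congr fun n => eLpNorm_congr_ae ?_
    filter_upwards [(hf n).coeFn_toLp] with x hx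
    simp [hx]
  have h2 : Filter.Tendsto (fun n => inner ℝ ((hf n).toLp (f n)) (hg.toLp g)) Filter.atTop
      (𝓝 (inner ℝ u (hg.toLp g))) := h1.inner tendsto_const_nhds
  simp only [L2.inner_def] at h2
  have e : ∫ x, inner ℝ (u x) (hg.toLp g x) ∂μ = ∫ x, inner ℝ (u x) (g x) ∂μ := by
    refine integral_congr_ae ?_
    filter_upwards [hg.coeFn_toLp] with x hx
    rw [hx]
  rw [e] at h2
  refine h2.congr fun n => integral_congr_ae ?_
  filter_upwards [hg.coeFn_toLp, (hf n).coeFn_toLp] with x hx hx'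
  rw [hx, hx']

lemma MemLp.of_continuous_restrict {F : Type*} [NormedAddCommGroup F] {f : E3 → F}
    (hf : Continuous f) (hc : HasCompactSupport f) : MemLp f 2 (volume.restrict (Ω : Set E3)) :=
  (hf.memLp_of_hasCompactSupport hc).restrict _

/-- A field of `H₀(curl; Ω)`, extended by zero, satisfies the integration by parts formula on the
whole space. -/
lemma integral_inner_curl_of_tendsto {u w : L2v Ω} {φ : ℕ → 𝓓(Ω, E3)}
    (hu : Filter.Tendsto (fun n => eLpNorm (fun x => φ n x - u x) 2
      ((volume : Measure E3).restrict (Ω : Set E3))) Filter.atTop (𝓝 0))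
    (hw : Filter.Tendsto (fun n => eLpNorm (fun x => curl (φ n) x - w x) 2
      ((volume : Measure E3).restrict (Ω : Set E3))) Filter.atTop (𝓝 0))
    {ψ : E3 → E3} (hψ : ContDiff ℝ 1 ψ) (hc : HasCompactSupport ψ) :
    ∫ x in (Ω : Set E3), inner ℝ (u x) (curl ψ x) = ∫ x in (Ω : Set E3), inner ℝ (w x) (ψ x) := by
  have h1 := tendsto_integral_inner
    (fun n => MemLp.of_continuous_restrict (φ n).continuous (φ n).hasCompactSupport)
    (MemLp.of_continuous_restrict (continuous_curl hψ)
      (hasCompactSupport_of_tsupport hc fun x hx => curl_eq_zero hx)) hu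
  have h2 := tendsto_integral_inner
    (fun n => MemLp.of_continuous_restrict (continuous_curl (contDiff_one_test (φ n)))
      (hasCompactSupport_of_tsupport (φ n).hasCompactSupport fun x hx => curl_eq_zero hx))
    (MemLp.of_continuous_restrict hψ.continuous hc) hw
  refine tendsto_nhds_unique h1 (h2.congr fun n => ?_)
  -- The approximants vanish off `Ω`, so the integrals extend to the whole space without a boundary
  -- term, although `ψ` need not vanish on the boundary.
  have hΩ : ∀ x ∉ (Ω : Set E3), x ∉ tsupport (φ n) := fun x hx h => hx ((φ n).tsupport_subset h)
  rw [setIntegral_eq_integral_of_forall_compl_eq_zero,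
    setIntegral_eq_integral_of_forall_compl_eq_zero,
    integral_inner_curl (contDiff_one_test (φ n)) hψ (φ n).hasCompactSupport]
  · intro x hx
    rw [image_eq_zero_of_notMem_tsupport (hΩ x hx), inner_zero_left]
  · intro x hx
    rw [curl_eq_zero (hΩ x hx), inner_zero_left]

lemma isWeakGrad_of_tendsto {s : L2s Ω} {g : L2v Ω} {φ : ℕ → 𝓓(Ω, ℝ)}
    (hs : Filter.Tendsto (fun n => eLpNorm (fun x => φ n x - s x) 2
      ((volume : Measure E3).restrict (Ω : Set E3))) Filter.atTop (𝓝 0))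
    (hg : Filter.Tendsto (fun n => eLpNorm (fun x => gradient (φ n) x - g x) 2
      ((volume : Measure E3).restrict (Ω : Set E3))) Filter.atTop (𝓝 0)) :
    IsWeakGrad Ω s g := by
  intro ψ
  have hd : Continuous (divergence ψ) :=
    continuous_finsetSum _ fun i _ => continuous_partialD (contDiff_one_test ψ) i i
  have h1 := tendsto_integral_inner
    (fun n => MemLp.of_continuous_restrict (φ n).continuous (φ n).hasCompactSupport)
    (MemLp.of_continuous_restrict hd
      (hasCompactSupport_of_tsupport ψ.hasCompactSupport fun x hx => divergence_eq_zero hx)) hs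
  have h2 := tendsto_integral_inner
    (fun n => MemLp.of_continuous_restrict (continuous_gradient (contDiff_one_test (φ n)))
      (hasCompactSupport_of_tsupport (φ n).hasCompactSupport fun x hx => gradient_eq_zero hx))
    (MemLp.of_continuous_restrict ψ.continuous ψ.hasCompactSupport) hg
  simp only [RCLike.inner_apply, conj_trivial, mul_comm (divergence ψ _)] at h1
  refine tendsto_nhds_unique h1 (h2.neg.congr fun n => ?_)
  have hΩ : ∀ x ∉ (Ω : Set E3), x ∉ tsupport (φ n) := fun x hx h => hx ((φ n).tsupport_subset h)
  rw [setIntegral_eq_integral_of_forall_compl_eq_zero,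
    setIntegral_eq_integral_of_forall_compl_eq_zero,
    integral_mul_divergence (contDiff_one_test (φ n)) (contDiff_one_test ψ)
      (φ n).hasCompactSupport]
  · intro x hx
    rw [image_eq_zero_of_notMem_tsupport (hΩ x hx), zero_mul]
  · intro x hx
    rw [gradient_eq_zero (hΩ x hx), inner_zero_left]

lemma IsWeakCurl.unique {u w w' : L2v Ω} (h : IsWeakCurl Ω u w) (h' : IsWeakCurl Ω u w') :
    w = w' := by
  have hl : LocallyIntegrable (w - w' : L2v Ω) (volume.restrict (Ω : Set E3)) :=
    (Lp.memLp (w - w')).locallyIntegrable (by norm_num)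
  have hae := Ω.isOpen.ae_eq_zero_of_integral_contDiff_smul_eq_zero (hl.locallyIntegrableOn Ω) (by
    intro g hg hgc hgs
    have hgi := hl.integrable_smul_left_of_hasCompactSupport hg.continuous hgc
    -- The vector-valued integral is tested against fixed vectors `c`, which corresponds to the test
    -- fields `g • c`.
    refine ext_inner_left ℝ fun c => ?_
    have hs : tsupport (fun x => g x • c) ⊆ Ω :=
      (closure_mono (Function.support_smul_subset_left g fun _ => c)).trans hgs
    let ψ : 𝓓(Ω, E3) := ⟨fun x => g x • c, hg.smul contDiff_const, hgc.smul_right, hs⟩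
    have hψ := (h ψ).symm.trans (h' ψ)
    have e := (innerSL ℝ c).integral_comp_comm hgi
    simp only [innerSL_apply_apply] at e
    rw [← e, inner_zero_right, ← sub_eq_zero.2 hψ,
      ← integral_sub (integrable_inner_test w ψ) (integrable_inner_test w' ψ)]
    refine integral_congr_ae ?_
    filter_upwards [Lp.coeFn_sub w w'] with x hx
    have hψx : ψ x = g x • c := rfl
    rw [hx, hψx, Pi.sub_apply, ← inner_sub_left, inner_smul_right, inner_smul_right,
      real_inner_comm])
  refine sub_eq_zero.1 (Lp.ext ?_)
  filter_upwards [hae, ae_restrict_mem Ω.isOpen.measurableSet,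
    Lp.coeFn_zero E3 2 (volume.restrict (Ω : Set E3))] with x h1 h2 h3
  rw [h1 h2, h3, Pi.zero_apply]

end WeakDerivatives

/-! ### Lipschitz functions vanishing off `Ω` belong to `H¹₀(Ω)`. -/

section LipschitzH10

variable {Ω : Opens E3}

lemma tendsto_eLpNorm_zero {F : Type*} [NormedAddCommGroup F] {μ : Measure E3}
    [IsFiniteMeasure μ] {f : ℕ → E3 → F} (hf : ∀ n, AEStronglyMeasurable (f n) μ) {C : ℝ}
    (hC : ∀ n, ∀ᵐ x ∂μ, ‖f n x‖ ≤ C)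
    (h : ∀ᵐ x ∂μ, Filter.Tendsto (fun n => f n x) Filter.atTop (𝓝 0)) :
    Filter.Tendsto (fun n => eLpNorm (f n) 2 μ) Filter.atTop (𝓝 0) := by
  have h1 : Filter.Tendsto (fun n => ∫⁻ x, ‖f n x‖ₑ ^ (2 : ℝ) ∂μ) Filter.atTop
      (𝓝 (∫⁻ _, 0 ∂μ)) := by
    refine tendsto_lintegral_of_dominated_convergence' (fun _ => ENNReal.ofReal C ^ (2 : ℝ))
      (fun n => (hf n).enorm.pow_const _) (fun n => ?_) ?_ ?_
    · filter_upwards [hC n] with x hx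
      rw [← ofReal_norm]
      gcongr
    · rw [lintegral_const]
      exact ENNReal.mul_ne_top (by simp) (measure_ne_top _ _)
    · filter_upwards [h] with x hx
      have h2 : Filter.Tendsto (fun n => ‖f n x‖ₑ) Filter.atTop (𝓝 0) := by
        simpa using hx.enorm
      simpa [Function.comp_def] using
        (ENNReal.continuous_rpow_const (y := 2)).continuousAt.tendsto.comp h2
  rw [lintegral_zero] at h1
  have h3 := (ENNReal.continuous_rpow_const (y := 1 / 2)).continuousAt.tendsto.comp h1
  rw [ENNReal.zero_rpow_of_pos (by norm_num)] at h3
  refine h3.congr fun n => ?_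
  rw [eLpNorm_eq_lintegral_rpow_enorm_toReal (by norm_num) (by norm_num)]
  simp

/-- The soft thresholding function. -/
def softThreshold (δ t : ℝ) : ℝ := max (t - δ) (min 0 (t + δ))

lemma lipschitzWith_softThreshold (δ : ℝ) : LipschitzWith 1 (softThreshold δ) := by
  have h1 : LipschitzWith 1 fun t : ℝ => t - δ :=
    LipschitzWith.of_dist_le_mul fun x y => by simp
  have h2 : LipschitzWith 1 fun t : ℝ => t + δ :=
    LipschitzWith.of_dist_le_mul fun x y => by simp
  have h3 := h1.max (h2.const_min 0)
  rwa [max_self] at h3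

lemma softThreshold_of_abs_le {δ t : ℝ} (h : |t| ≤ δ) : softThreshold δ t = 0 := by
  rw [abs_le] at h
  rw [softThreshold, min_eq_left (by linarith), max_eq_right (by linarith)]

lemma softThreshold_of_le {δ t : ℝ} (hδ : 0 ≤ δ) (h : δ ≤ t) : softThreshold δ t = t - δ := by
  rw [softThreshold, min_eq_left (by linarith), max_eq_left (by linarith)]

lemma softThreshold_of_le_neg {δ t : ℝ} (hδ : 0 ≤ δ) (h : t ≤ -δ) :
    softThreshold δ t = t + δ := by
  rw [softThreshold, min_eq_right (by linarith), max_eq_right (by linarith)]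

lemma abs_softThreshold_sub_le {δ : ℝ} (hδ : 0 ≤ δ) (t : ℝ) : |softThreshold δ t - t| ≤ δ := by
  rcases le_total |t| δ with h | h
  · rwa [softThreshold_of_abs_le h, zero_sub, abs_neg]
  · rcases le_abs.1 h with h | h
    · rw [softThreshold_of_le hδ h]
      simp [abs_of_nonneg hδ]
    · rw [softThreshold_of_le_neg hδ (by linarith)]
      simp [abs_of_nonneg hδ]

/-- Thresholding confines the support to `{δ ≤ |s|}`, a compact subset of `Ω`, and leaves room for a
small mollification. The condition `n ≤ m` keeps the radii tending to zero. -/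
lemma exists_test_mollify (hΩ : Bornology.IsBounded (Ω : Set E3)) {s : E3 → ℝ} {L : ℝ≥0}
    (hs : LipschitzWith L s) (h0 : ∀ x ∉ Ω, s x = 0) (n : ℕ) :
    ∃ (m : ℕ) (φ : 𝓓(Ω, ℝ)), n ≤ m ∧
      (φ : E3 → ℝ) = mollify (bump m) (fun x => softThreshold (1 / ((n : ℝ) + 1)) (s x)) := by
  set δ : ℝ := 1 / ((n : ℝ) + 1) with hδ
  have hδ0 : 0 < δ := by positivity
  set C : Set E3 := {x | δ ≤ |s x|} with hC
  have hCΩ : C ⊆ Ω := fun x hx => by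
    by_contra h
    have hx' : δ ≤ |s x| := hx
    rw [h0 x h, abs_zero] at hx'
    linarith
  have hCc : IsCompact C := Metric.isCompact_of_isClosed_isBounded
    (isClosed_le continuous_const hs.continuous.abs) (hΩ.subset hCΩ)
  obtain ⟨r, hr, hrΩ⟩ := hCc.exists_cthickening_subset_open Ω.isOpen hCΩ
  obtain ⟨m, hm, hnm⟩ := ((tendsto_bump_rOut.eventually (gt_mem_nhds hr)).and
    (Filter.eventually_ge_atTop n)).exists
  have hlip : LipschitzWith L fun x => softThreshold δ (s x) := by
    simpa [Function.comp_def] using (lipschitzWith_softThreshold δ).comp hs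
  have hsub : tsupport (mollify (bump m) fun x => softThreshold δ (s x))
      ⊆ Metric.cthickening r C := by
    refine closure_minimal ?_ Metric.isClosed_cthickening
    refine (support_mollify_subset _ _).trans ((Metric.thickening_subset_of_subset _ ?_).trans
      (Metric.thickening_subset_cthickening_of_le hm.le C))
    intro x hx
    by_contra h
    exact hx (softThreshold_of_abs_le (not_le.1 h).le)
  exact ⟨m, ⟨_, contDiff_mollify _ hlip.continuous.locallyIntegrable,
    hCc.cthickening.of_isClosed_subset (isClosed_tsupport _) hsub, hsub.trans hrΩ⟩, hnm, rfl⟩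

lemma norm_gradient_le_of_lipschitz {f : E3 → ℝ} {L : ℝ≥0} (hf : LipschitzWith L f) (x : E3) :
    ‖gradient f x‖ ≤ L := by
  rw [gradient, LinearIsometryEquiv.norm_map]
  exact norm_fderiv_le_of_lipschitz ℝ hf

lemma gradient_mollify_of_affine (ρ : ContDiffBump (0 : E3)) {f : E3 → ℝ} {x a : E3} {R c : ℝ}
    (h : ∀ z ∈ Metric.ball x R, f z = c + inner ℝ a (z - x)) (hR : ρ.rOut < R) :
    gradient (mollify ρ f) x = a := by
  have h1 := hasFDerivAt_mollify_of_affine ρ (f := f) (x := x) (c - inner ℝ a x) (innerSL ℝ a)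
    (Filter.Eventually.of_forall fun z hz => by
      rw [h z hz, inner_sub_right, innerSL_apply_apply]
      ring) hR
  exact HasGradientAt.gradient (hasGradientAt_iff_hasFDerivAt.2 h1)

/-- Where `s x ≠ 0`, the function keeps its sign and stays above half its size nearby, so small
thresholds merely subtract a constant. Where `s x = 0`, the assumption `a = 0` makes `s` vanish on
the ball. The radius must not depend on `n`, since the bump has to fit inside it. -/
lemma eventually_softThreshold_affine {s : E3 → ℝ} (hs : Continuous s) {x a : E3} {R : ℝ}
    (hR : 0 < R) (h : ∀ z ∈ Metric.ball x R, s z = s x + inner ℝ a (z - x))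
    (ha : s x = 0 → a = 0) :
    ∃ R' > 0, ∀ᶠ n : ℕ in Filter.atTop, ∃ c, ∀ z ∈ Metric.ball x R',
      softThreshold (1 / ((n : ℝ) + 1)) (s z) = c + inner ℝ a (z - x) := by
  by_cases hx : s x = 0
  · refine ⟨R, hR, Filter.Eventually.of_forall fun n => ⟨0, fun z hz => ?_⟩⟩
    rw [h z hz, hx, ha hx, inner_zero_left, add_zero,
      softThreshold_of_abs_le (by rw [abs_zero]; positivity)]
  · have hev : ∀ᶠ z in 𝓝 x, |s x| / 2 < |s z| ∧ 0 < s x * s z := by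
      refine (hs.abs.continuousAt.eventually (lt_mem_nhds (half_lt_self (abs_pos.2 hx)))).and ?_
      refine (continuous_const.mul hs).continuousAt.eventually (lt_mem_nhds (mul_self_pos.2 hx))
    obtain ⟨R₁, hR₁, h₁⟩ := Metric.eventually_nhds_iff_ball.1 hev
    refine ⟨min R R₁, lt_min hR hR₁, ?_⟩
    have hpos : 0 < |s x| / 2 := half_pos (abs_pos.2 hx)
    filter_upwards [tendsto_one_div_add_atTop_nhds_zero_nat.eventually (gt_mem_nhds hpos)]
      with n hn
    have hδ : (0 : ℝ) ≤ 1 / ((n : ℝ) + 1) := by positivity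
    rcases lt_or_gt_of_ne hx with hx | hx
    · refine ⟨s x + 1 / ((n : ℝ) + 1), fun z hz => ?_⟩
      obtain ⟨h2, h3⟩ := h₁ z (Metric.ball_subset_ball (min_le_right _ _) hz)
      have h4 : s z < 0 := by
        by_contra h5
        nlinarith
      rw [abs_of_neg h4] at h2
      rw [softThreshold_of_le_neg hδ (by linarith),
        h z (Metric.ball_subset_ball (min_le_left _ _) hz)]
      ring
    · refine ⟨s x - 1 / ((n : ℝ) + 1), fun z hz => ?_⟩
      obtain ⟨h2, h3⟩ := h₁ z (Metric.ball_subset_ball (min_le_right _ _) hz)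
      have h4 : 0 < s z := by
        by_contra h5
        nlinarith
      rw [abs_of_pos h4] at h2
      rw [softThreshold_of_le hδ (by linarith),
        h z (Metric.ball_subset_ball (min_le_left _ _) hz)]
      ring

/-- A Lipschitz function which vanishes outside of a bounded open set `Ω` and is locally affine
almost everywhere can be approximated in `H¹(Ω)` by test functions. -/
theorem exists_test_tendsto_of_lipschitz (hΩ : Bornology.IsBounded (Ω : Set E3)) {s : E3 → ℝ}
    {L : ℝ≥0} (hs : LipschitzWith L s) (h0 : ∀ x ∉ Ω, s x = 0) {S : L2s Ω} {u : L2v Ω}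
    (hS : S =ᵐ[volume.restrict (Ω : Set E3)] s)
    (hL : ∀ᵐ x ∂(volume.restrict (Ω : Set E3)), ‖u x‖ ≤ L)
    (hloc : ∀ᵐ x ∂(volume.restrict (Ω : Set E3)), (s x = 0 → u x = 0) ∧
      ∃ R > 0, ∀ z ∈ Metric.ball x R, s z = s x + inner ℝ (u x) (z - x)) :
    ∃ φ : ℕ → 𝓓(Ω, ℝ),
      Filter.Tendsto (fun n => eLpNorm (fun x => φ n x - S x) 2
        ((volume : Measure E3).restrict (Ω : Set E3))) Filter.atTop (𝓝 0) ∧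
      Filter.Tendsto (fun n => eLpNorm (fun x => gradient (φ n) x - u x) 2
        ((volume : Measure E3).restrict (Ω : Set E3))) Filter.atTop (𝓝 0) := by
  have hfin : IsFiniteMeasure ((volume : Measure E3).restrict (Ω : Set E3)) :=
    isFiniteMeasure_restrict.2 hΩ.measure_lt_top.ne
  choose m φ hm hφ using exists_test_mollify hΩ hs h0
  have hlip : ∀ n : ℕ, LipschitzWith L fun x => softThreshold (1 / ((n : ℝ) + 1)) (s x) := fun n => by
    simpa [Function.comp_def] using (lipschitzWith_softThreshold (1 / ((n : ℝ) + 1))).comp hs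
  have hmt : Filter.Tendsto m Filter.atTop Filter.atTop :=
    Filter.tendsto_atTop_mono hm Filter.tendsto_id
  have hrt := tendsto_bump_rOut.comp hmt
  have hd : ∀ n x, ‖φ n x - s x‖ ≤ L * (bump (m n)).rOut + 1 / ((n : ℝ) + 1) := by
    intro n x
    have h1 := dist_mollify_le (bump (m n)) (hlip n) x
    have h2 := abs_softThreshold_sub_le (δ := 1 / ((n : ℝ) + 1)) (by positivity) (s x)
    rw [hφ, ← dist_eq_norm]
    exact (dist_triangle _ _ _).trans (add_le_add h1 h2)
  have hdt : Filter.Tendsto (fun n : ℕ => L * (bump (m n)).rOut + 1 / ((n : ℝ) + 1))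
      Filter.atTop (𝓝 0) := by
    simpa using (hrt.const_mul (L : ℝ)).add tendsto_one_div_add_atTop_nhds_zero_nat
  refine ⟨φ, tendsto_eLpNorm_zero (C := L + 1) (fun n =>
    (φ n).continuous.aestronglyMeasurable.sub (Lp.aestronglyMeasurable S)) (fun n => ?_) ?_,
    tendsto_eLpNorm_zero (C := L + L) (fun n =>
    (continuous_gradient (contDiff_one_test (φ n))).aestronglyMeasurable.sub
      (Lp.aestronglyMeasurable u)) (fun n => ?_) ?_⟩
  · filter_upwards [hS] with x hx
    rw [hx]
    refine (hd n x).trans (add_le_add ?_ ?_)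
    · refine mul_le_of_le_one_right L.2 ?_
      show 1 / ((m n : ℝ) + 1) ≤ 1
      rw [div_le_one (by positivity)]
      linarith [(Nat.cast_nonneg (m n) : (0 : ℝ) ≤ m n)]
    · rw [div_le_one (by positivity)]
      linarith [(Nat.cast_nonneg n : (0 : ℝ) ≤ n)]
  · filter_upwards [hS] with x hx
    rw [hx]
    exact squeeze_zero_norm (fun n => hd n x) hdt
  · filter_upwards [hL] with x hx
    refine (norm_sub_le _ _).trans (add_le_add ?_ hx)
    rw [hφ]
    exact norm_gradient_le_of_lipschitz (lipschitzWith_mollify _ (hlip n)) x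
  -- Pointwise convergence of the gradients is eventual equality: once the bump fits into the ball
  -- where the truncation is affine, its gradient at `x` is exactly `u x`.
  · filter_upwards [hloc] with x ⟨hx, R, hR, hxR⟩
    obtain ⟨R', hR', hev⟩ := eventually_softThreshold_affine hs.continuous hR hxR hx
    refine tendsto_const_nhds.congr' ?_
    filter_upwards [hev, hrt.eventually (gt_mem_nhds hR')] with n ⟨c, hc⟩ hn
    rw [hφ, gradient_mollify_of_affine _ hc hn, sub_self]

end LipschitzH10

/-! ### Curl-free Nédélec fields are gradients. -/

section Exactness

variable {Ω : Opens E3} {K : Geometry.SimplicialComplex ℝ E3}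

/-- The map `v ↦ b × v` is skew-symmetric, so symmetry annihilates it. -/
lemma cross_eq_zero {b : E3} (h : ∀ v w : E3, inner ℝ (cross b v) w = inner ℝ (cross b w) v) :
    b = 0 := by
  have h01 := h (EuclideanSpace.single 0 1) (EuclideanSpace.single 1 1)
  have h02 := h (EuclideanSpace.single 0 1) (EuclideanSpace.single 2 1)
  have h12 := h (EuclideanSpace.single 1 1) (EuclideanSpace.single 2 1)
  simp [cross, crossProduct, PiLp.inner_apply] at h01 h02 h12
  ext i
  fin_cases i <;> simp <;> linarith

/-- The cross product with a fixed vector as a continuous linear map. -/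
def crossL (b : E3) : E3 →L[ℝ] E3 :=
  LinearMap.toContinuousLinearMap
    { toFun := cross b
      map_add' := fun x y => by simp [cross]
      map_smul' := fun c x => by simp [cross] }

lemma crossL_apply (b x : E3) : crossL b x = cross b x := rfl

/-- A sufficiently fine mollification has derivative `b × ·` at `x`, and this derivative is
symmetric. -/
lemma eq_zero_of_isCurlFree {u : E3 → E3} (hu : LocallyIntegrable u volume) (hc : IsCurlFree u)
    {a b x : E3} {R : ℝ} (hR : 0 < R) (h : ∀ᵐ z, z ∈ Metric.ball x R → u z = a + cross b z) :
    b = 0 := by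
  obtain ⟨n, hn⟩ := (tendsto_bump_rOut.eventually (gt_mem_nhds hR)).exists
  have hd := (hasFDerivAt_mollify_of_affine (bump n) a (crossL b) h hn).fderiv
  refine cross_eq_zero fun v w => ?_
  have := fderiv_mollify_symm (bump n) hu hc x v w
  rwa [hd] at this

/-- The hyperplane is closed and convex with empty interior, so it equals its own frontier, which is
null. -/
lemma volume_setOf_inner_eq {a : E3} (ha : a ≠ 0) (k : ℝ) :
    (volume : Measure E3) {z | inner ℝ a z = k} = 0 := by
  have hcl : IsClosed {z : E3 | inner ℝ a z = k} :=
    isClosed_eq (by fun_prop) continuous_const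
  have hconv : Convex ℝ {z : E3 | inner ℝ a z = k} :=
    convex_hyperplane (f := fun z => inner ℝ a z) ⟨fun x y => inner_add_right a x y,
      fun c x => inner_smul_right a x c⟩ k
  refine measure_mono_null ?_ (hconv.addHaar_frontier volume)
  rw [hcl.frontier_eq]
  refine fun x hx => ⟨hx, fun hxi => ha ?_⟩
  have hc : Continuous fun t : ℝ => x + t • a := by fun_prop
  have ht : Filter.Tendsto (fun t : ℝ => x + t • a) (𝓝[>] 0) (𝓝 x) := by
    simpa using (hc.tendsto 0).mono_left nhdsWithin_le_nhds
  obtain ⟨t, ht0, hti⟩ := ((eventually_mem_nhdsWithin (a := (0 : ℝ)) (s := Set.Ioi 0)).and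
    (ht.eventually (isOpen_interior.mem_nhds hxi))).exists
  have hti' : x + t • a ∈ {z : E3 | inner ℝ a z = k} := interior_subset hti
  have h1 : inner ℝ a (x + t • a) = k := hti'
  have h2 : inner ℝ a x = k := hx
  rw [inner_add_right, h2, inner_smul_right] at h1
  have h3 : t * inner ℝ a a = 0 := by linarith
  exact inner_self_eq_zero.1 ((mul_eq_zero.1 h3).resolve_left (ne_of_gt ht0))

/-- On a convex open set on which a function is locally affine with slope `a`, it is affine. -/
lemma exists_eq_affine {s : E3 → ℝ} {I : Set E3} (hI : IsOpen I) (hIc : Convex ℝ I) {a : E3}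
    (h : ∀ x R, Metric.ball x R ⊆ I → ∀ y ∈ Metric.ball x R, s y = s x + inner ℝ a (y - x)) :
    ∃ c, ∀ z ∈ I, s z = c + inner ℝ a z := by
  rcases I.eq_empty_or_nonempty with rfl | ⟨x₀, hx₀⟩
  · exact ⟨0, fun z hz => absurd hz (Set.notMem_empty z)⟩
  · refine ⟨s x₀ - inner ℝ a x₀, fun z hz => ?_⟩
    have := eq_of_isPreconnected (s := fun z => s z - inner ℝ a z) hIc.isPreconnected
      (fun y hy => by
        obtain ⟨R, hR, hRI⟩ := Metric.isOpen_iff.1 hI y hy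
        filter_upwards [Metric.ball_mem_nhds y hR] with w hw _
        rw [h y R hRI w hw, inner_sub_right]
        ring) hz hx₀
    linarith

/-- The extension by zero of a curl-free field of the Nédélec space is curl-free. -/
lemma isCurlFree_indicator {u : L2v Ω} (hu : MemH0curl Ω u) (h0 : IsWeakCurl Ω u 0) :
    IsCurlFree ((Ω : Set E3).indicator u) := by
  obtain ⟨w, φ, h1, h2⟩ := hu
  have hw : IsWeakCurl Ω u w := fun ψ =>
    integral_inner_curl_of_tendsto h1 h2 (contDiff_one_test ψ) ψ.hasCompactSupport
  have hw0 : w = 0 := hw.unique h0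
  intro ψ hψ hψc
  have h3 := integral_inner_curl_of_tendsto h1 h2 (hψ.of_le (by exact_mod_cast le_top)) hψc
  have e1 : ∫ x in (Ω : Set E3), inner ℝ (w x) (ψ x) = 0 := by
    refine integral_eq_zero_of_ae ?_
    filter_upwards [Lp.coeFn_zero E3 2 (volume.restrict (Ω : Set E3))] with x hx
    rw [hw0, hx, Pi.zero_apply, inner_zero_left, Pi.zero_apply]
  rw [← h3.trans e1, ← integral_indicator Ω.isOpen.measurableSet]
  refine integral_congr_ae (Filter.Eventually.of_forall fun x => ?_)
  by_cases hx : x ∈ (Ω : Set E3) <;> simp [hx]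

lemma locallyIntegrable_indicator (u : L2v Ω) :
    LocallyIntegrable ((Ω : Set E3).indicator u) volume :=
  ((memLp_indicator_iff_restrict Ω.isOpen.measurableSet).2 (Lp.memLp u)).locallyIntegrable
    (by norm_num)

/-- A curl-free field of the Nédélec space is constant on each tetrahedron. -/
lemma exists_eq_const_interior (hΩ : IsBoundedLipschitzDomain Ω) (hK : IsTetMesh Ω K) {u : L2v Ω}
    (hu : u ∈ nedelec Ω K) (h0 : IsWeakCurl Ω u 0) (T : Finset E3) :
    ∃ a : E3, IsCell K T → ∀ᵐ z, z ∈ interior (convexHull ℝ (T : Set E3)) →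
      (Ω : Set E3).indicator u z = a := by
  by_cases hT : IsCell K T
  · obtain ⟨a, b, hab⟩ := hu.2 T hT
    have hTΩ := hK.interior_subset hΩ hT
    have h1 : ∀ᵐ z, z ∈ interior (convexHull ℝ (T : Set E3)) →
        (Ω : Set E3).indicator u z = a + cross b z := by
      have := (ae_restrict_iff' Ω.isOpen.measurableSet).1 hab
      filter_upwards [this] with z hz hzT
      rw [Set.indicator_of_mem (hTΩ hzT)]
      exact hz (hTΩ hzT) (interior_subset hzT)
    -- For empty interior the claim is vacuous, so nondegeneracy of the tetrahedron need not be
    -- proved.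
    rcases (interior (convexHull ℝ (T : Set E3))).eq_empty_or_nonempty with he | ⟨x, hx⟩
    · exact ⟨0, fun _ => by simp [he]⟩
    · obtain ⟨R, hR, hRT⟩ := Metric.isOpen_iff.1 isOpen_interior x hx
      have hb : b = 0 := eq_zero_of_isCurlFree (locallyIntegrable_indicator u)
        (isCurlFree_indicator hu.1 h0) hR (h1.mono fun z hz hzR => hz (hRT hzR))
      refine ⟨a, fun _ => h1.mono fun z hz hzT => ?_⟩
      rw [hz hzT, hb]
      simp [cross]
  · exact ⟨0, fun h => absurd h hT⟩

/-- Exactness of the discrete complex: curl-free fields of the Nédélec space are gradients. -/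
theorem mem_gradSh_of_isWeakCurl_zero (hΩ : IsBoundedLipschitzDomain Ω)
    (hfr : IsConnected (frontier (Ω : Set E3))) (hK : IsTetMesh Ω K) {u : L2v Ω}
    (hu : u ∈ nedelec Ω K) (h0 : IsWeakCurl Ω u 0) : u ∈ gradSh Ω K := by
  choose a ha using exists_eq_const_interior hΩ hK hu h0
  set L : ℝ≥0 := ∑ T ∈ hK.finite.toFinset, ‖a T‖₊ with hLdef
  have haL : ∀ T, IsCell K T → ‖a T‖ ≤ L := by
    intro T hT
    have : ‖a T‖₊ ≤ L := Finset.single_le_sum (f := fun T => ‖a T‖₊) (fun _ _ => zero_le)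
      (hK.finite.mem_toFinset.2 hT.1)
    exact_mod_cast this
  have hcells : ∀ᵐ z, ∀ T ∈ K.faces, IsCell K T → z ∈ interior (convexHull ℝ (T : Set E3)) →
      (Ω : Set E3).indicator u z = a T := by
    rw [ae_ball_iff hK.finite.countable]
    intro T _
    by_cases hT : IsCell K T
    · exact (ha T hT).mono fun z hz _ => hz
    · exact Filter.Eventually.of_forall fun z h => absurd h hT
  have hbound : ∀ᵐ z, ‖(Ω : Set E3).indicator u z‖ ≤ L := by
    filter_upwards [hcells, hK.ae_mem_interior] with z h1 h2
    by_cases hz : z ∈ Ω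
    · obtain ⟨T, hT, hzT⟩ := h2 hz
      rw [h1 T hT.1 hT hzT]
      exact haL T hT
    · rw [Set.indicator_of_notMem hz, norm_zero]
      exact L.2
  obtain ⟨s₀, hs₀, haff⟩ := exists_lipschitz_potential (locallyIntegrable_indicator u) hbound
    (isCurlFree_indicator hu.1 h0)
  -- The extended field vanishes in the exterior, so the potential is locally constant there.
  obtain ⟨c, hc⟩ := exists_eq_const_compl hΩ hfr hs₀.continuous fun y hy => by
    obtain ⟨R, hR, hRy⟩ := Metric.isOpen_iff.1 isClosed_closure.isOpen_compl y hy
    filter_upwards [Metric.ball_mem_nhds y hR] with z hz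
    have := haff y R 0 (Filter.Eventually.of_forall fun w hw =>
      Set.indicator_of_notMem (fun h => hRy hw (subset_closure h)) _) z hz
    rwa [inner_zero_left, add_zero] at this
  set s : E3 → ℝ := fun x => s₀ x - c with hs
  have hslip : LipschitzWith L s := LipschitzWith.of_dist_le_mul fun x y => by
    simpa [hs, dist_sub_right] using hs₀.dist_le_mul x y
  have hs0 : ∀ x ∉ Ω, s x = 0 := fun x hx => sub_eq_zero.2 (hc x hx)
  have hball : ∀ T, IsCell K T → ∀ x R, Metric.ball x R ⊆ interior (convexHull ℝ (T : Set E3)) →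
      ∀ y ∈ Metric.ball x R, s y = s x + inner ℝ (a T) (y - x) := by
    intro T hT x R hR y hy
    have := haff x R (a T) ((ha T hT).mono fun z hz hzR => hz (hR hzR)) y hy
    simp only [hs, this]
    ring
  have hcell : ∀ T, ∃ c, IsCell K T → ∀ z ∈ interior (convexHull ℝ (T : Set E3)),
      s z = c + inner ℝ (a T) z := by
    intro T
    by_cases hT : IsCell K T
    · obtain ⟨c, hc⟩ := exists_eq_affine isOpen_interior
        (convex_convexHull ℝ (T : Set E3)).interior (hball T hT)
      exact ⟨c, fun _ => hc⟩
    · exact ⟨0, fun h => absurd h hT⟩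
  choose k hk using hcell
  -- On a cell with nonzero slope the zeros of `s` lie in a null hyperplane. Hence almost everywhere
  -- `s x = 0` implies `u x = 0`, as the approximation theorem requires.
  have hnull : ∀ᵐ z, ∀ T ∈ K.faces, a T ≠ 0 → inner ℝ (a T) z ≠ -k T := by
    rw [ae_ball_iff hK.finite.countable]
    intro T _
    by_cases hT : a T = 0
    · exact Filter.Eventually.of_forall fun z h => absurd hT h
    · have := measure_eq_zero_iff_ae_notMem.1 (volume_setOf_inner_eq hT (-k T))
      exact this.mono fun z hz _ => hz
  have hmem : MemLp s 2 (volume.restrict (Ω : Set E3)) :=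
    MemLp.of_continuous_restrict hslip.continuous
      (HasCompactSupport.intro hΩ.bounded.isCompact_closure
        fun x hx => hs0 x fun h => hx (subset_closure h))
  obtain ⟨φ, hφ1, hφ2⟩ := exists_test_tendsto_of_lipschitz hΩ.bounded hslip hs0 (u := u)
    hmem.coeFn_toLp (by
      rw [ae_restrict_iff' Ω.isOpen.measurableSet]
      filter_upwards [hbound] with x hx hxΩ
      rwa [Set.indicator_of_mem hxΩ] at hx) (by
      rw [ae_restrict_iff' Ω.isOpen.measurableSet]
      filter_upwards [hcells, hK.ae_mem_interior, hnull] with x h1 h2 h3 hxΩ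
      obtain ⟨T, hT, hxT⟩ := h2 hxΩ
      have hux := h1 T hT.1 hT hxT
      rw [Set.indicator_of_mem hxΩ] at hux
      rw [hux]
      refine ⟨fun hsx => ?_, ?_⟩
      · by_contra haT
        refine h3 T hT.1 haT ?_
        rw [hk T hT x hxT] at hsx
        linarith
      · obtain ⟨R, hR, hRT⟩ := Metric.isOpen_iff.1 isOpen_interior x hxT
        exact ⟨R, hR, hball T hT x R hRT⟩)
  refine ⟨hmem.toLp s, ⟨⟨u, φ, hφ1, hφ2⟩, fun T hT => ⟨k T, a T, ?_⟩⟩,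
    isWeakGrad_of_tendsto hφ1 hφ2⟩
  have hfrT : ∀ᵐ z ∂(volume.restrict (Ω : Set E3)), z ∉ frontier (convexHull ℝ (T : Set E3)) :=
    ae_restrict_of_ae (measure_eq_zero_iff_ae_notMem.1
      ((convex_convexHull ℝ (T : Set E3)).addHaar_frontier volume))
  unfold EqOnCell
  filter_upwards [hfrT, hmem.coeFn_toLp] with z hz hzs hzT
  rw [hzs]
  refine hk T hT z ?_
  by_contra h
  exact hz ⟨subset_closure hzT, h⟩

end Exactness

/-! ### Finite dimensionality, and the curl as a linear map. -/

section DiscreteSpaces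

variable {Ω : Opens E3} {K : Geometry.SimplicialComplex ℝ E3}

lemma memLp_cellField (hΩ : Bornology.IsBounded (Ω : Set E3)) {D : Set E3} (hD : MeasurableSet D)
    (p : E3 × E3) :
    MemLp (D.indicator fun x => p.1 + crossL p.2 x) 2 (volume.restrict (Ω : Set E3)) := by
  refine MemLp.indicator hD ?_
  have hfin : IsFiniteMeasure ((volume : Measure E3).restrict (Ω : Set E3)) :=
    isFiniteMeasure_restrict.2 hΩ.measure_lt_top.ne
  obtain ⟨C, hC⟩ := hΩ.exists_norm_le
  refine MemLp.of_bound (by fun_prop) (‖p.1‖ + ‖crossL p.2‖ * C) ?_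
  filter_upwards [ae_restrict_mem Ω.isOpen.measurableSet] with x hx
  refine (norm_add_le _ _).trans (add_le_add le_rfl (((crossL p.2).le_opNorm x).trans ?_))
  exact mul_le_mul_of_nonneg_left (hC x hx) (norm_nonneg _)

/-- The linear map sending `(a, b)` to the field `a + b × x` on `D`, extended by zero. -/
def cellField (hΩ : Bornology.IsBounded (Ω : Set E3)) {D : Set E3} (hD : MeasurableSet D) :
    E3 × E3 →ₗ[ℝ] L2v Ω where
  toFun p := (memLp_cellField hΩ hD p).toLp _
  map_add' p q := by
    rw [← MemLp.toLp_add]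
    refine MemLp.toLp_congr _ _ (Filter.Eventually.of_forall fun x => ?_)
    by_cases hx : x ∈ D
    · simp only [Set.indicator_of_mem hx, Pi.add_apply, crossL_apply, Prod.fst_add, Prod.snd_add,
        cross_add_left]
      abel
    · simp [Set.indicator_of_notMem hx]
  map_smul' c p := by
    rw [RingHom.id_apply, ← MemLp.toLp_const_smul]
    refine MemLp.toLp_congr _ _ (Filter.Eventually.of_forall fun x => ?_)
    by_cases hx : x ∈ D
    · simp only [Set.indicator_of_mem hx, Pi.smul_apply, crossL_apply, Prod.smul_fst,
        Prod.smul_snd, cross_smul_left, smul_add]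
    · simp [Set.indicator_of_notMem hx]

lemma coeFn_cellField (hΩ : Bornology.IsBounded (Ω : Set E3)) {D : Set E3} (hD : MeasurableSet D)
    (p : E3 × E3) : cellField hΩ hD p =ᵐ[volume.restrict (Ω : Set E3)]
      D.indicator fun x => p.1 + cross p.2 x :=
  (memLp_cellField hΩ hD p).coeFn_toLp

/-- The fields of the form `a + b × x` on each cell lie in a finite-dimensional space. -/
lemma exists_finiteDimensional (hΩ : IsBoundedLipschitzDomain Ω) (hK : IsTetMesh Ω K) :
    ∃ W : Submodule ℝ (L2v Ω), FiniteDimensional ℝ W ∧ ∀ v : L2v Ω,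
      (∀ T, IsCell K T → ∃ a b : E3, EqOnCell Ω T v fun x => a + cross b x) → v ∈ W := by
  classical
  set 𝒯 := hK.finite.toFinset.filter fun T => T.card = 4 with h𝒯
  have hcell : ∀ T, T ∈ 𝒯 ↔ IsCell K T := fun T => by simp [h𝒯, IsCell]
  set C : Fin 𝒯.card → Set E3 := fun i => convexHull ℝ ((𝒯.equivFin.symm i).1 : Set E3) with hC
  have hCm : ∀ i, MeasurableSet (C i) := fun i =>
    (Set.Finite.isCompact_convexHull (𝕜 := ℝ) (Finset.finite_toSet _)).isClosed.measurableSet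
  -- Removing the earlier cells makes the pieces disjoint, so overlaps of cells need no separate
  -- argument: a point is assigned to the first cell containing it.
  set D : Fin 𝒯.card → Set E3 := fun i => C i \ ⋃ j : Fin 𝒯.card, ⋃ _ : j < i, C j with hD
  have hDm : ∀ i, MeasurableSet (D i) := fun i =>
    (hCm i).diff (MeasurableSet.iUnion fun j => MeasurableSet.iUnion fun _ => hCm j)
  refine ⟨⨆ i, LinearMap.range (cellField hΩ.bounded (hDm i)), inferInstance, fun v hv => ?_⟩
  choose a b hab using fun i : Fin 𝒯.card => hv _ ((hcell _).1 (𝒯.equivFin.symm i).2)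
  have hsum : v = ∑ i, cellField hΩ.bounded (hDm i) (a i, b i) := by
    refine Lp.ext ?_
    have h1 : ∀ᵐ x ∂(volume.restrict (Ω : Set E3)), ∀ i, x ∈ C i → v x = a i + cross (b i) x :=
      ae_all_iff.2 hab
    have h2 : ∀ᵐ x ∂(volume.restrict (Ω : Set E3)), ∀ i,
        cellField hΩ.bounded (hDm i) (a i, b i) x
          = (D i).indicator (fun x => a i + cross (b i) x) x :=
      ae_all_iff.2 fun i => coeFn_cellField hΩ.bounded (hDm i) (a i, b i)
    filter_upwards [h1, h2, Lp.coeFn_finsetSum Finset.univ fun i =>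
      cellField hΩ.bounded (hDm i) (a i, b i), ae_restrict_mem Ω.isOpen.measurableSet,
      ae_restrict_of_ae hK.ae_mem_interior] with x hx1 hx2 hx3 hxΩ hx4
    obtain ⟨T, hT, hxT⟩ := hx4 hxΩ
    have hex : (Finset.univ.filter fun i => x ∈ C i).Nonempty := by
      refine ⟨𝒯.equivFin ⟨T, (hcell T).2 hT⟩, ?_⟩
      simpa [hC] using interior_subset hxT
    obtain ⟨i, hi, hmin⟩ := Finset.exists_min_image _ id hex
    have hxi : x ∈ C i := (Finset.mem_filter.1 hi).2
    have hxD : x ∈ D i := by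
      refine ⟨hxi, fun h => ?_⟩
      obtain ⟨j, hji, hxj⟩ := Set.mem_iUnion₂.1 h
      exact absurd (hmin j (by simpa using hxj)) (not_le.2 hji)
    rw [hx3, Finset.sum_apply, Finset.sum_eq_single i, hx2, Set.indicator_of_mem hxD, hx1 i hxi]
    · intro j _ hj
      rw [hx2, Set.indicator_of_notMem]
      intro hxj
      rcases lt_or_gt_of_ne hj with h | h
      · exact absurd (hmin j (by simpa using hxj.1)) (not_le.2 h)
      · exact hxj.2 (Set.mem_iUnion₂.2 ⟨i, h, hxi⟩)
    · exact fun h => absurd (Finset.mem_univ i) h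
  rw [hsum]
  exact Submodule.sum_mem _ fun i _ => Submodule.mem_iSup_of_mem i ⟨_, rfl⟩

lemma finiteDimensional_nedelec (hΩ : IsBoundedLipschitzDomain Ω) (hK : IsTetMesh Ω K) :
    FiniteDimensional ℝ (nedelec Ω K) := by
  obtain ⟨W, hW, h⟩ := exists_finiteDimensional hΩ hK
  exact Submodule.finiteDimensional_of_le fun v hv => h v hv.2

lemma finiteDimensional_Qh (hΩ : IsBoundedLipschitzDomain Ω) (hK : IsTetMesh Ω K) :
    FiniteDimensional ℝ (Qh Ω K) := by
  obtain ⟨W, hW, h⟩ := exists_finiteDimensional hΩ hK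
  refine Submodule.finiteDimensional_of_le (S₂ := W) fun v hv => h v fun T hT => ?_
  obtain ⟨c, hc⟩ := hv T hT
  exact ⟨c, 0, by simpa [cross] using hc⟩

lemma integrable_curl_test (u : L2v Ω) (φ : 𝓓(Ω, E3)) :
    Integrable (fun x => inner ℝ (u x) (curl φ x)) (volume.restrict (Ω : Set E3)) := by
  have h : MemLp (curl φ) 2 (volume.restrict (Ω : Set E3)) :=
    MemLp.of_continuous_restrict (continuous_curl (contDiff_one_test φ))
      (hasCompactSupport_of_tsupport φ.hasCompactSupport fun x hx => curl_eq_zero hx)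
  refine (L2.integrable_inner (𝕜 := ℝ) u (h.toLp _)).congr ?_
  filter_upwards [h.coeFn_toLp] with x hx
  rw [hx]

lemma IsWeakCurl.add {u v w z : L2v Ω} (hu : IsWeakCurl Ω u w) (hv : IsWeakCurl Ω v z) :
    IsWeakCurl Ω (u + v) (w + z) := by
  intro φ
  have e : ∀ (p q : L2v Ω) (g : E3 → E3),
      (fun x => inner ℝ ((p + q : L2v Ω) x) (g x)) =ᵐ[volume.restrict (Ω : Set E3)]
        fun x => inner ℝ (p x) (g x) + inner ℝ (q x) (g x) := by
    intro p q g
    filter_upwards [Lp.coeFn_add p q] with x hx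
    rw [hx, Pi.add_apply, inner_add_left]
  rw [integral_congr_ae (e _ _ _), integral_congr_ae (e _ _ _),
    integral_add (integrable_curl_test u φ) (integrable_curl_test v φ),
    integral_add (integrable_inner_test w φ) (integrable_inner_test z φ), hu φ, hv φ]

lemma IsWeakCurl.smul (c : ℝ) {u w : L2v Ω} (hu : IsWeakCurl Ω u w) :
    IsWeakCurl Ω (c • u) (c • w) := by
  intro φ
  have e : ∀ (p : L2v Ω) (g : E3 → E3),
      (fun x => inner ℝ ((c • p : L2v Ω) x) (g x)) =ᵐ[volume.restrict (Ω : Set E3)]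
        fun x => c * inner ℝ (p x) (g x) := by
    intro p g
    filter_upwards [Lp.coeFn_smul c p] with x hx
    rw [hx, Pi.smul_apply, real_inner_smul_left]
  rw [integral_congr_ae (e _ _), integral_congr_ae (e _ _), integral_const_mul,
    integral_const_mul, hu φ]

lemma isWeakCurl_weakCurl {u : L2v Ω} (hu : MemH0curl Ω u) : IsWeakCurl Ω u (weakCurl Ω u) := by
  have h : ∃ w, IsWeakCurl Ω u w := by
    obtain ⟨w, φ, h1, h2⟩ := hu
    exact ⟨w, fun ψ => integral_inner_curl_of_tendsto h1 h2 (contDiff_one_test ψ)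
      ψ.hasCompactSupport⟩
  rw [weakCurl, dif_pos h]
  exact h.choose_spec

/-- The weak curl as a linear map on a subspace of the Nédélec space. -/
def curlMap {V : Submodule ℝ (L2v Ω)} (hV : V ≤ nedelec Ω K) : V →ₗ[ℝ] L2v Ω where
  toFun v := weakCurl Ω v
  map_add' u v := (isWeakCurl_weakCurl (hV (u + v).2).1).unique
    ((isWeakCurl_weakCurl (hV u.2).1).add (isWeakCurl_weakCurl (hV v.2).1))
  map_smul' c u := (isWeakCurl_weakCurl (hV (c • u).2).1).unique
    ((isWeakCurl_weakCurl (hV u.2).1).smul c)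

/-- The curl is injective on gauged subspaces of the Nédélec space. -/
lemma ker_curlMap_eq_bot (hΩ : IsBoundedLipschitzDomain Ω)
    (hfr : IsConnected (frontier (Ω : Set E3))) (hK : IsTetMesh Ω K) {V : Submodule ℝ (L2v Ω)}
    (hV : V ≤ nedelec Ω K) (hg : gradSh Ω K ⊓ V = ⊥) : LinearMap.ker (curlMap hV) = ⊥ := by
  rw [LinearMap.ker_eq_bot']
  intro v hv
  have h0 : IsWeakCurl Ω v 0 := by
    have := isWeakCurl_weakCurl (hV v.2).1
    rwa [show weakCurl Ω v = 0 from hv] at this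
  have hmem : (v : L2v Ω) ∈ gradSh Ω K ⊓ V :=
    ⟨mem_gradSh_of_isWeakCurl_zero hΩ hfr hK (hV v.2) h0, v.2⟩
  rw [hg, Submodule.mem_bot] at hmem
  exact Subtype.ext hmem

end DiscreteSpaces

/-! ### Continuity and strict convexity of the energy density. -/

section EnergyDensity

/-- The internal energy density as a real-valued function. -/
def energyReal (As Js : ℝ) (J : E3) : ℝ :=
  -(2 * As * Js / Real.pi) * Real.log (Real.cos (Real.pi / 2 * (‖J‖ / Js)))

lemma energyDensity_of_lt {As Js : ℝ} {J : E3} (h : ‖J‖ < Js) :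
    energyDensity As Js J = ENNReal.ofReal (energyReal As Js J) := if_pos h

lemma energyDensity_of_le {As Js : ℝ} {J : E3} (h : Js ≤ ‖J‖) : energyDensity As Js J = ⊤ :=
  if_neg (not_lt.2 h)

lemma angle_mem {Js : ℝ} (hJs : 0 < Js) {J : E3} (h : ‖J‖ < Js) :
    0 ≤ Real.pi / 2 * (‖J‖ / Js) ∧ Real.pi / 2 * (‖J‖ / Js) < Real.pi / 2 := by
  have hπ := Real.pi_pos
  refine ⟨by positivity, mul_lt_of_lt_one_right (by positivity) ?_⟩
  rwa [div_lt_one hJs]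

lemma cos_angle_pos {Js : ℝ} (hJs : 0 < Js) {J : E3} (h : ‖J‖ < Js) :
    0 < Real.cos (Real.pi / 2 * (‖J‖ / Js)) := by
  obtain ⟨h1, h2⟩ := angle_mem hJs h
  exact Real.cos_pos_of_mem_Ioo ⟨by linarith [Real.pi_pos], h2⟩

lemma energyReal_nonneg {As Js : ℝ} (hAs : 0 < As) (hJs : 0 < Js) {J : E3} (h : ‖J‖ < Js) :
    0 ≤ energyReal As Js J := by
  have h1 := Real.log_nonpos (cos_angle_pos hJs h).le (Real.cos_le_one _)
  have h2 : 0 ≤ 2 * As * Js / Real.pi := by positivity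
  rw [energyReal, neg_mul]
  linarith [mul_nonneg_of_nonpos_of_nonpos (neg_nonpos.2 h2) h1]

/-- The cosine tends to `0` as `|J|` increases to `J_s`, so the logarithmic barrier joins
continuously to the value `⊤`. -/
lemma continuous_energyDensity {As Js : ℝ} (hAs : 0 < As) (hJs : 0 < Js) :
    Continuous (energyDensity As Js) := by
  have hθ : Continuous fun J : E3 => Real.cos (Real.pi / 2 * (‖J‖ / Js)) := by fun_prop
  have hk : 0 < 2 * As * Js / Real.pi := by positivity
  refine continuous_iff_continuousAt.2 fun J => ?_
  rcases lt_or_ge ‖J‖ Js with h | h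
  · have hev : energyDensity As Js =ᶠ[𝓝 J] fun J => ENNReal.ofReal (energyReal As Js J) := by
      filter_upwards [continuous_norm.continuousAt.eventually (gt_mem_nhds h)] with z hz
      exact energyDensity_of_lt hz
    refine ContinuousAt.congr ?_ hev.symm
    refine ENNReal.continuous_ofReal.continuousAt.comp ?_
    exact continuousAt_const.mul (hθ.continuousAt.log (cos_angle_pos hJs h).ne')
  · rw [ContinuousAt, energyDensity_of_le h, ENNReal.tendsto_nhds_top_iff_nnreal]
    intro M
    -- The exponential is the cosine value at which the energy equals `M`. If `‖J‖ = Js` the cosine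
    -- is near `0`; if `‖J‖ > Js` the first alternative holds nearby.
    have hev : ∀ᶠ z in 𝓝 J, Js < ‖z‖ ∨ Real.cos (Real.pi / 2 * (‖z‖ / Js))
        < Real.exp (-(M / (2 * As * Js / Real.pi))) := by
      rcases h.eq_or_lt with h | h
      · refine (hθ.continuousAt.eventually (gt_mem_nhds ?_)).mono fun z hz => Or.inr hz
        simp only
        rw [← h, div_self hJs.ne', mul_one, Real.cos_pi_div_two]
        exact Real.exp_pos _
      · exact (continuous_norm.continuousAt.eventually (lt_mem_nhds h)).mono fun z hz => Or.inl hz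
    filter_upwards [hev] with z hz
    rcases lt_or_ge ‖z‖ Js with hz' | hz'
    · have h1 := (Real.log_lt_iff_lt_exp (cos_angle_pos hJs hz')).2
        (hz.resolve_left (not_lt.2 hz'.le))
      rw [energyDensity_of_lt hz', energyReal, ← ENNReal.ofReal_coe_nnreal]
      have h2 : (M : ℝ) < -(2 * As * Js / Real.pi)
          * Real.log (Real.cos (Real.pi / 2 * (‖z‖ / Js))) := by
        have := mul_lt_mul_of_pos_left h1 hk
        rw [mul_neg, mul_div_cancel₀ _ hk.ne'] at this
        linarith
      exact (ENNReal.ofReal_lt_ofReal_iff (lt_of_le_of_lt M.2 h2)).2 h2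
    · rw [energyDensity_of_le hz']
      exact ENNReal.coe_lt_top

lemma norm_midpoint_sq (x y : E3) :
    ‖(1 / 2 : ℝ) • (x + y)‖ ^ 2 = (‖x‖ ^ 2 + ‖y‖ ^ 2) / 2 - ‖x - y‖ ^ 2 / 4 := by
  have := parallelogram_law_with_norm ℝ x y
  rw [norm_smul, mul_pow]
  norm_num
  nlinarith

lemma norm_midpoint_le (x y : E3) : ‖(1 / 2 : ℝ) • (x + y)‖ ≤ (‖x‖ + ‖y‖) / 2 := by
  rw [norm_smul]
  norm_num
  linarith [norm_add_le x y]

/-- Twice the left side is `cos (α + β) + cos (α - β)`, twice the right side is `cos (α + β) + 1`.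
After taking logarithms this is midpoint convexity of `-log cos`. -/
lemma cos_mul_cos_le {α β : ℝ} : Real.cos α * Real.cos β ≤ Real.cos ((α + β) / 2) ^ 2 := by
  have h1 := Real.cos_sq ((α + β) / 2)
  rw [mul_div_cancel₀ _ (two_ne_zero)] at h1
  have h2 := Real.cos_le_one (α - β)
  rw [Real.cos_sub] at h2
  rw [Real.cos_add] at h1
  linarith

lemma cos_mul_cos_lt {α β : ℝ} (hα : 0 ≤ α) (hα' : α < Real.pi / 2) (hβ : 0 ≤ β)
    (hβ' : β < Real.pi / 2) (h : α ≠ β) :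
    Real.cos α * Real.cos β < Real.cos ((α + β) / 2) ^ 2 := by
  have h1 := Real.cos_sq ((α + β) / 2)
  rw [mul_div_cancel₀ _ (two_ne_zero)] at h1
  have h2 : Real.cos (α - β) < 1 := by
    refine lt_of_le_of_ne (Real.cos_le_one _) fun h3 => h ?_
    exact sub_eq_zero.1 ((Real.cos_eq_one_iff_of_lt_of_lt (by linarith [Real.pi_pos])
      (by linarith [Real.pi_pos])).1 h3)
  rw [Real.cos_sub] at h2
  rw [Real.cos_add] at h1
  linarith

/-- The internal energy density is strictly midpoint convex on its domain. -/
lemma energyReal_midpoint {As Js : ℝ} (hAs : 0 < As) (hJs : 0 < Js) {x y : E3} (hx : ‖x‖ < Js)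
    (hy : ‖y‖ < Js) :
    ‖(1 / 2 : ℝ) • (x + y)‖ < Js ∧
    energyReal As Js ((1 / 2 : ℝ) • (x + y)) ≤ (energyReal As Js x + energyReal As Js y) / 2 ∧
    (x ≠ y → energyReal As Js ((1 / 2 : ℝ) • (x + y))
      < (energyReal As Js x + energyReal As Js y) / 2) := by
  have hm := norm_midpoint_le x y
  have hmJ : ‖(1 / 2 : ℝ) • (x + y)‖ < Js := by linarith
  have hπ := Real.pi_pos
  have hk : 0 < 2 * As * Js / Real.pi := by positivity
  obtain ⟨hα, hα'⟩ := angle_mem hJs hx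
  obtain ⟨hβ, hβ'⟩ := angle_mem hJs hy
  obtain ⟨hγ, hγ'⟩ := angle_mem hJs hmJ
  have cx := cos_angle_pos hJs hx
  have cy := cos_angle_pos hJs hy
  have cm := cos_angle_pos hJs hmJ
  set α := Real.pi / 2 * (‖x‖ / Js) with hαd
  set β := Real.pi / 2 * (‖y‖ / Js) with hβd
  set γ := Real.pi / 2 * (‖(1 / 2 : ℝ) • (x + y)‖ / Js) with hγd
  have hγle : γ ≤ (α + β) / 2 := by
    have : (α + β) / 2 = Real.pi / 2 * (((‖x‖ + ‖y‖) / 2) / Js) := by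
      rw [hαd, hβd]
      ring
    rw [this, hγd]
    gcongr
  have hcos : Real.cos ((α + β) / 2) ≤ Real.cos γ :=
    Real.cos_le_cos_of_nonneg_of_le_pi hγ (by linarith) hγle
  have hcm : 0 < Real.cos ((α + β) / 2) :=
    Real.cos_pos_of_mem_Ioo ⟨by linarith, by linarith⟩
  have key : ∀ {a b : ℝ}, 0 < a → 0 < b → ∀ c, 0 < c →
      (a * b ≤ c ^ 2 → Real.log a + Real.log b ≤ 2 * Real.log c) ∧
      (a * b < c ^ 2 → Real.log a + Real.log b < 2 * Real.log c) := by
    intro a b ha hb c hc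
    have e : 2 * Real.log c = Real.log (c ^ 2) := by
      rw [Real.log_pow]
      norm_num
    rw [← Real.log_mul ha.ne' hb.ne', e]
    exact ⟨fun h => Real.log_le_log (mul_pos ha hb) h, fun h => Real.log_lt_log (mul_pos ha hb) h⟩
  obtain ⟨k1, k2⟩ := key cx cy _ cm
  refine ⟨hmJ, ?_, fun hne => ?_⟩
  · have h1 := k1 (cos_mul_cos_le.trans (pow_le_pow_left₀ hcm.le hcos 2))
    have h2 := mul_le_mul_of_nonneg_left h1 hk.le
    simp only [energyReal]
    rw [← hαd, ← hβd, ← hγd]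
    linarith
  · have h0 : Real.cos α * Real.cos β < Real.cos γ ^ 2 := by
      -- For equal norms strictness comes from the parallelogram law, which makes the midpoint
      -- strictly shorter; for different norms it comes from strict convexity of `-log cos`.
      rcases eq_or_ne ‖x‖ ‖y‖ with h | h
      · have hαβ : α = β := by rw [hαd, hβd, h]
        have hlt : ‖(1 / 2 : ℝ) • (x + y)‖ < ‖x‖ := by
          refine lt_of_pow_lt_pow_left₀ 2 (norm_nonneg _) ?_
          rw [norm_midpoint_sq, ← h]
          have : 0 < ‖x - y‖ := norm_pos_iff.2 (sub_ne_zero.2 hne)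
          nlinarith
        have hγα : γ < α := by
          rw [hγd, hαd]
          gcongr
        have := Real.cos_lt_cos_of_nonneg_of_le_pi hγ (by linarith) hγα
        rw [← hαβ, ← sq]
        exact pow_lt_pow_left₀ this cx.le two_ne_zero
      · have hαβ : α ≠ β := by
          intro h'
          refine h ?_
          have h3 := mul_left_cancel₀ (by positivity : Real.pi / 2 ≠ 0) h'
          exact (div_left_inj' hJs.ne').1 h3
        exact (cos_mul_cos_lt hα hα' hβ hβ' hαβ).trans_le (pow_le_pow_left₀ hcm.le hcos 2)
    have h2 := mul_lt_mul_of_pos_left (k2 h0) hk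
    simp only [energyReal]
    rw [← hαd, ← hβd, ← hγd]
    linarith

lemma regNorm_nonneg (ε : ℝ) (x : E3) : 0 ≤ regNorm ε x := Real.sqrt_nonneg _

/-- `regNorm ε x` is the Euclidean norm of `(x, √ε)`; `h1` below is Cauchy–Schwarz for `(‖x‖, √ε)`
and `(‖y‖, √ε)`. -/
lemma regNorm_midpoint {ε : ℝ} (hε : 0 ≤ ε) (x y : E3) :
    regNorm ε ((1 / 2 : ℝ) • (x + y)) ≤ (regNorm ε x + regNorm ε y) / 2 := by
  have hx : 0 ≤ ‖x‖ ^ 2 + ε := by positivity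
  have hy : 0 ≤ ‖y‖ ^ 2 + ε := by positivity
  have h1 : ‖x‖ * ‖y‖ + ε ≤ regNorm ε x * regNorm ε y := by
    rw [regNorm, regNorm, ← Real.sqrt_mul hx]
    refine Real.le_sqrt_of_sq_le ?_
    nlinarith [mul_nonneg hε (sq_nonneg (‖x‖ - ‖y‖))]
  have h2 : regNorm ε x ^ 2 = ‖x‖ ^ 2 + ε := Real.sq_sqrt hx
  have h3 : regNorm ε y ^ 2 = ‖y‖ ^ 2 + ε := Real.sq_sqrt hy
  have h4 := pow_le_pow_left₀ (norm_nonneg _) (norm_midpoint_le x y) 2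
  rw [regNorm]
  refine Real.sqrt_le_iff.2 ⟨by linarith [regNorm_nonneg ε x, regNorm_nonneg ε y], ?_⟩
  nlinarith

lemma continuous_regNorm (ε : ℝ) : Continuous (regNorm ε) := by
  unfold regNorm
  fun_prop

lemma regNorm_le {ε : ℝ} (hε : 0 ≤ ε) (x : E3) : regNorm ε x ≤ ‖x‖ + Real.sqrt ε := by
  refine Real.sqrt_le_iff.2 ⟨by positivity, ?_⟩
  nlinarith [Real.sq_sqrt hε, norm_nonneg x, Real.sqrt_nonneg ε,
    mul_nonneg (norm_nonneg x) (Real.sqrt_nonneg ε)]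

/-- The nonnegative part of the energy density, as a function of `curl A`, `J` and `J_p`. -/
def density (ν₀ As Js χ ε : ℝ) (c J z : E3) : ℝ≥0∞ :=
  ENNReal.ofReal (ν₀ / 2 * ‖c - J‖ ^ 2) + energyDensity As Js J
    + ENNReal.ofReal (χ * regNorm ε (J - z))

lemma continuous_density {ν₀ As Js χ ε : ℝ} (hAs : 0 < As) (hJs : 0 < Js) :
    Continuous fun p : E3 × E3 × E3 => density ν₀ As Js χ ε p.1 p.2.1 p.2.2 := by
  have h1 := continuous_energyDensity hAs hJs
  have h2 := continuous_regNorm ε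
  unfold density
  refine ((ENNReal.continuous_ofReal.comp ?_).add (h1.comp ?_)).add
    (ENNReal.continuous_ofReal.comp ?_) <;> fun_prop

lemma norm_lt_of_density_lt_top {ν₀ As Js χ ε : ℝ} {c J z : E3}
    (h : density ν₀ As Js χ ε c J z < ⊤) : ‖J‖ < Js := by
  by_contra h'
  rw [density, energyDensity_of_le (not_lt.1 h')] at h
  simp at h

lemma density_eq_ofReal {ν₀ As Js χ ε : ℝ} (hν : 0 < ν₀) (hAs : 0 < As) (hJs : 0 < Js)
    (hχ : 0 ≤ χ) {c J z : E3} (h : ‖J‖ < Js) :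
    density ν₀ As Js χ ε c J z = ENNReal.ofReal
      (ν₀ / 2 * ‖c - J‖ ^ 2 + energyReal As Js J + χ * regNorm ε (J - z)) := by
  have h1 := energyReal_nonneg hAs hJs h
  have h2 : 0 ≤ ν₀ / 2 * ‖c - J‖ ^ 2 := by positivity
  rw [density, energyDensity_of_lt h, ENNReal.ofReal_add (add_nonneg h2 h1)
    (mul_nonneg hχ (regNorm_nonneg ε _)), ENNReal.ofReal_add h2 h1]

/-- The density is midpoint convex, and strictly so in the pair `(curl A, J)`. -/
lemma density_midpoint {ν₀ As Js χ ε : ℝ} (hν : 0 < ν₀) (hAs : 0 < As) (hJs : 0 < Js)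
    (hχ : 0 ≤ χ) (hε : 0 ≤ ε) {c₁ c₂ J₁ J₂ z : E3} (h₁ : ‖J₁‖ < Js) (h₂ : ‖J₂‖ < Js) :
    density ν₀ As Js χ ε ((1 / 2 : ℝ) • (c₁ + c₂)) ((1 / 2 : ℝ) • (J₁ + J₂)) z
      ≤ (density ν₀ As Js χ ε c₁ J₁ z + density ν₀ As Js χ ε c₂ J₂ z) / 2 ∧
    (density ν₀ As Js χ ε ((1 / 2 : ℝ) • (c₁ + c₂)) ((1 / 2 : ℝ) • (J₁ + J₂)) z
      = (density ν₀ As Js χ ε c₁ J₁ z + density ν₀ As Js χ ε c₂ J₂ z) / 2 →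
        c₁ = c₂ ∧ J₁ = J₂) := by
  obtain ⟨hm, hle, hlt⟩ := energyReal_midpoint hAs hJs h₁ h₂
  have e1 : (1 / 2 : ℝ) • (c₁ + c₂) - (1 / 2 : ℝ) • (J₁ + J₂)
      = (1 / 2 : ℝ) • ((c₁ - J₁) + (c₂ - J₂)) := by
    rw [← smul_sub]
    congr 1
    abel
  have e2 : (1 / 2 : ℝ) • (J₁ + J₂) - z = (1 / 2 : ℝ) • ((J₁ - z) + (J₂ - z)) := by
    have : z = (1 / 2 : ℝ) • (z + z) := by
      rw [← two_smul ℝ z, smul_smul]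
      norm_num
    nth_rw 1 [this]
    rw [← smul_sub]
    congr 1
    abel
  have hq := norm_midpoint_sq (c₁ - J₁) (c₂ - J₂)
  have hr := mul_le_mul_of_nonneg_left (regNorm_midpoint hε (J₁ - z) (J₂ - z)) hχ
  have n1 := energyReal_nonneg hAs hJs h₁
  have n2 := energyReal_nonneg hAs hJs h₂
  have m1 := mul_nonneg hχ (regNorm_nonneg ε (J₁ - z))
  have m2 := mul_nonneg hχ (regNorm_nonneg ε (J₂ - z))
  have q1 : 0 ≤ ν₀ / 2 * ‖c₁ - J₁‖ ^ 2 := by positivity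
  have q2 : 0 ≤ ν₀ / 2 * ‖c₂ - J₂‖ ^ 2 := by positivity
  have q3 : 0 ≤ ν₀ / 2 * ‖c₁ - J₁ - (c₂ - J₂)‖ ^ 2 := by positivity
  have hdiv : ∀ t : ℝ, ENNReal.ofReal t / 2 = ENNReal.ofReal (t / 2) := fun t => by
    rw [ENNReal.ofReal_div_of_pos two_pos, ENNReal.ofReal_ofNat]
  rw [density_eq_ofReal hν hAs hJs hχ hm, density_eq_ofReal hν hAs hJs hχ h₁,
    density_eq_ofReal hν hAs hJs hχ h₂, ← ENNReal.ofReal_add (by positivity) (by positivity),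
    hdiv, e1, e2, hq]
  refine ⟨ENNReal.ofReal_le_ofReal (by linarith), fun h => ?_⟩
  -- The quadratic term sees only `c - J`, so `J` has to be identified first, through the strict
  -- convexity of `U`.
  have hJ : J₁ = J₂ := by
    by_contra hne
    have h3 := hlt hne
    have h5 := energyReal_nonneg hAs hJs hm
    exact absurd h (ne_of_lt ((ENNReal.ofReal_lt_ofReal_iff (by linarith)).2 (by linarith)))
  refine ⟨?_, hJ⟩
  by_contra hne
  have h4 : 0 < ν₀ / 2 * ‖c₁ - J₁ - (c₂ - J₂)‖ ^ 2 := by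
    have : 0 < ‖c₁ - J₁ - (c₂ - J₂)‖ := by
      rw [norm_pos_iff, hJ, sub_sub_sub_cancel_right]
      exact sub_ne_zero.2 hne
    positivity
  have h5 : 0 ≤ ν₀ / 2 * ‖(1 / 2 : ℝ) • (c₁ - J₁ + (c₂ - J₂))‖ ^ 2 := by positivity
  rw [hq] at h5
  exact absurd h (ne_of_lt ((ENNReal.ofReal_lt_ofReal_iff (by linarith)).2 (by linarith)))

end EnergyDensity

/-! ### The direct method and uniqueness. -/

section Minimization

attribute [local irreducible] density

variable {Ω : Opens E3} {X Y : Type*} [NormedAddCommGroup X] [NormedSpace ℝ X]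
  [NormedAddCommGroup Y] [NormedSpace ℝ Y]

/-- The nonnegative part of the energy. -/
def nonnegEnergy (Ω : Opens E3) (ν₀ As Js χ ε : ℝ) (Jp c J : L2v Ω) : ℝ≥0∞ :=
  ∫⁻ x in (Ω : Set E3), density ν₀ As Js χ ε (c x) (J x) (Jp x)

lemma aemeasurable_density {ν₀ As Js χ ε : ℝ} (hAs : 0 < As) (hJs : 0 < Js) (c J z : L2v Ω) :
    AEMeasurable (fun x => density ν₀ As Js χ ε (c x) (J x) (z x))
      (volume.restrict (Ω : Set E3)) := by
  have h1 : AEMeasurable (fun x => (c x, J x, z x)) (volume.restrict (Ω : Set E3)) :=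
    (Lp.aestronglyMeasurable c).aemeasurable.prodMk
      ((Lp.aestronglyMeasurable J).aemeasurable.prodMk (Lp.aestronglyMeasurable z).aemeasurable)
  have h2 := (continuous_density (ν₀ := ν₀) (χ := χ) (ε := ε) hAs hJs).measurable.comp_aemeasurable
    h1
  simpa only [Function.comp_def] using h2

lemma exists_subseq_tendsto_ae {f : ℕ → L2v Ω} {g : L2v Ω}
    (h : Filter.Tendsto f Filter.atTop (𝓝 g)) :
    ∃ ns : ℕ → ℕ, StrictMono ns ∧ ∀ᵐ x ∂(volume.restrict (Ω : Set E3)),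
      Filter.Tendsto (fun i => f (ns i) x) Filter.atTop (𝓝 (g x)) :=
  (tendstoInMeasure_of_tendsto_Lp h).exists_seq_tendsto_ae

/-- Along a subsequence both fields converge almost everywhere; continuity of the density and
Fatou's lemma then show that sublevel sets are sequentially closed. -/
lemma lowerSemicontinuous_nonnegEnergy {X : Type*} [TopologicalSpace X] [SequentialSpace X]
    {ν₀ As Js χ ε : ℝ} (hAs : 0 < As) (hJs : 0 < Js) (Jp : L2v Ω) {c J : X → L2v Ω}
    (hc : Continuous c) (hJ : Continuous J) :
    LowerSemicontinuous fun p => nonnegEnergy Ω ν₀ As Js χ ε Jp (c p) (J p) := by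
  rw [lowerSemicontinuous_iff_isClosed_preimage]
  intro y
  refine IsSeqClosed.isClosed fun p p₀ hp hlim => ?_
  obtain ⟨n₁, hn₁, h₁⟩ := exists_subseq_tendsto_ae ((hc.tendsto p₀).comp hlim)
  obtain ⟨n₂, hn₂, h₂⟩ := exists_subseq_tendsto_ae
    (((hJ.tendsto p₀).comp hlim).comp hn₁.tendsto_atTop)
  have hae : ∀ᵐ x ∂(volume.restrict (Ω : Set E3)),
      density ν₀ As Js χ ε (c p₀ x) (J p₀ x) (Jp x) = Filter.liminf (fun i =>
        density ν₀ As Js χ ε (c (p (n₁ (n₂ i))) x) (J (p (n₁ (n₂ i))) x) (Jp x)) Filter.atTop := by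
    filter_upwards [h₁, h₂] with x h1 h2
    have h3 : Filter.Tendsto (fun i => (c (p (n₁ (n₂ i))) x, J (p (n₁ (n₂ i))) x, Jp x))
        Filter.atTop (𝓝 (c p₀ x, J p₀ x, Jp x)) :=
      (h1.comp hn₂.tendsto_atTop).prodMk_nhds (h2.prodMk_nhds tendsto_const_nhds)
    exact (((continuous_density (ν₀ := ν₀) (χ := χ) (ε := ε) hAs hJs).tendsto _).comp
      h3).liminf_eq.symm
  show nonnegEnergy Ω ν₀ As Js χ ε Jp (c p₀) (J p₀) ≤ y
  rw [nonnegEnergy, lintegral_congr_ae hae]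
  refine (lintegral_liminf_le' fun i => aemeasurable_density hAs hJs _ _ _).trans ?_
  exact Filter.liminf_le_of_frequently_le' (Filter.Frequently.of_forall fun i => hp (n₁ (n₂ i)))

/-- The zero pair is the competitor of finite energy: `U` vanishes at `0` and the remaining term is
integrable on the bounded domain. -/
lemma nonnegEnergy_zero_lt_top (hΩ : Bornology.IsBounded (Ω : Set E3)) {ν₀ As Js χ ε : ℝ}
    (hJs : 0 < Js) (hχ : 0 ≤ χ) (hε : 0 ≤ ε) (Jp : L2v Ω) :
    nonnegEnergy Ω ν₀ As Js χ ε Jp 0 0 < ⊤ := by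
  have hfin : IsFiniteMeasure ((volume : Measure E3).restrict (Ω : Set E3)) :=
    isFiniteMeasure_restrict.2 hΩ.measure_lt_top.ne
  have hi : Integrable (fun x => χ * (‖Jp x‖ + Real.sqrt ε)) (volume.restrict (Ω : Set E3)) :=
    (((Lp.memLp Jp).integrable (by norm_num)).norm.add (integrable_const _)).const_mul χ
  refine lt_of_le_of_lt (lintegral_mono_ae ?_) hi.lintegral_lt_top
  filter_upwards [Lp.coeFn_zero E3 2 (volume.restrict (Ω : Set E3))] with x hx
  rw [hx, Pi.zero_apply, density, energyDensity_of_lt (by rwa [norm_zero])]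
  simp only [energyReal, sub_zero, norm_zero, zero_div, mul_zero, Real.cos_zero, Real.log_one,
    ENNReal.ofReal_zero, zero_add, ne_eq, OfNat.ofNat_ne_zero, not_false_eq_true, zero_pow]
  refine ENNReal.ofReal_le_ofReal (mul_le_mul_of_nonneg_left ?_ hχ)
  refine (regNorm_le hε _).trans ?_
  rw [zero_sub, norm_neg]

lemma ae_norm_lt_of_nonnegEnergy {ν₀ As Js χ ε : ℝ} (hAs : 0 < As) (hJs : 0 < Js)
    {Jp c J : L2v Ω} (h : nonnegEnergy Ω ν₀ As Js χ ε Jp c J ≠ ⊤) :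
    ∀ᵐ x ∂(volume.restrict (Ω : Set E3)), ‖J x‖ < Js :=
  (ae_lt_top' (aemeasurable_density hAs hJs c J Jp) h).mono fun _ hx =>
    norm_lt_of_density_lt_top hx

lemma ofReal_norm_sq_le_nonnegEnergy {ν₀ As Js χ ε : ℝ} (hν : 0 < ν₀) (Jp c J : L2v Ω) :
    ENNReal.ofReal (ν₀ / 2 * ‖c - J‖ ^ 2) ≤ nonnegEnergy Ω ν₀ As Js χ ε Jp c J := by
  have e : ν₀ / 2 * ‖c - J‖ ^ 2
      = ∫ x in (Ω : Set E3), ν₀ / 2 * inner ℝ ((c - J : L2v Ω) x) ((c - J : L2v Ω) x) := by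
    rw [integral_const_mul, ← real_inner_self_eq_norm_sq, L2.inner_def]
  rw [e, ofReal_integral_eq_lintegral_ofReal ((L2.integrable_inner (𝕜 := ℝ) _ _).const_mul _)
    (Filter.Eventually.of_forall fun x => mul_nonneg (by positivity) real_inner_self_nonneg)]
  refine lintegral_mono_ae ?_
  filter_upwards [Lp.coeFn_sub c J] with x hx
  rw [hx, Pi.sub_apply, real_inner_self_eq_norm_sq, density, add_assoc]
  exact le_self_add

/-- The energy, as a function of `curl A`, `A` and `J`. -/
def totalEnergy (Ω : Opens E3) (ν₀ As Js χ ε : ℝ) (js Jp c A J : L2v Ω) : EReal :=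
  (nonnegEnergy Ω ν₀ As Js χ ε Jp c J : EReal) - ((inner ℝ js A : ℝ) : EReal)

lemma EReal.coe_ennreal_sub_le_iff {F G : ℝ≥0∞} {a b : ℝ} (hG : G ≠ ⊤) :
    (F : EReal) - (a : EReal) ≤ (G : EReal) - (b : EReal) ↔
      F ≠ ⊤ ∧ F.toReal - a ≤ G.toReal - b := by
  lift G to ℝ≥0 using hG
  rcases eq_or_ne F ⊤ with rfl | hF
  · simp only [ne_eq, not_true_eq_false, false_and, iff_false, not_le]
    rw [EReal.coe_ennreal_top, EReal.top_sub_coe]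
    exact_mod_cast EReal.coe_lt_top ((G : ℝ) - b)
  · lift F to ℝ≥0 using hF
    simp only [ne_eq, ENNReal.coe_ne_top, not_false_eq_true, true_and, ENNReal.coe_toReal]
    rw [EReal.coe_nnreal_eq_coe_real, EReal.coe_nnreal_eq_coe_real, ← EReal.coe_sub,
      ← EReal.coe_sub, EReal.coe_le_coe_iff]

lemma lowerSemicontinuous_totalEnergy {X : Type*} [TopologicalSpace X] [SequentialSpace X]
    {ν₀ As Js χ ε : ℝ} (hAs : 0 < As) (hJs : 0 < Js) (js Jp : L2v Ω) {c A J : X → L2v Ω}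
    (hc : Continuous c) (hA : Continuous A) (hJ : Continuous J) :
    LowerSemicontinuous fun p => totalEnergy Ω ν₀ As Js χ ε js Jp (c p) (A p) (J p) := by
  have h1 : LowerSemicontinuous fun p =>
      (nonnegEnergy Ω ν₀ As Js χ ε Jp (c p) (J p) : EReal) :=
    continuous_coe_ennreal_ereal.comp_lowerSemicontinuous
      (lowerSemicontinuous_nonnegEnergy hAs hJs Jp hc hJ) (fun _ _ h => EReal.coe_ennreal_le_coe_ennreal_iff.2 h)
  have h2 : Continuous fun p => -((inner ℝ js (A p) : ℝ) : EReal) :=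
    continuous_neg.comp (continuous_coe_real_ereal.comp (continuous_const.inner hA))
  refine (h1.add' h2.lowerSemicontinuous fun p => ?_ :)
  refine EReal.continuousAt_add (Or.inr ?_) (Or.inr ?_)
  · rw [← EReal.coe_neg]
    exact EReal.coe_ne_bot _
  · rw [← EReal.coe_neg]
    exact EReal.coe_ne_top _

lemma totalEnergy_le_iff {ν₀ As Js χ ε : ℝ} {js Jp c A J c' A' J' : L2v Ω}
    (h : nonnegEnergy Ω ν₀ As Js χ ε Jp c' J' ≠ ⊤) :
    totalEnergy Ω ν₀ As Js χ ε js Jp c A J ≤ totalEnergy Ω ν₀ As Js χ ε js Jp c' A' J' ↔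
      nonnegEnergy Ω ν₀ As Js χ ε Jp c J ≠ ⊤ ∧
        (nonnegEnergy Ω ν₀ As Js χ ε Jp c J).toReal - inner ℝ js A
          ≤ (nonnegEnergy Ω ν₀ As Js χ ε Jp c' J').toReal - inner ℝ js A' :=
  EReal.coe_ennreal_sub_le_iff h

/-- For `t ≥ 1` the right side is at most `(b + c) * t`. -/
lemma le_of_mul_sq_le {a b c t : ℝ} (ha : 0 < a) (hb : 0 ≤ b) (hc : 0 ≤ c)
    (h : a * t ^ 2 ≤ b + c * t) : t ≤ 1 + (b + c) / a := by
  have h0 : 0 ≤ (b + c) / a := by positivity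
  by_contra! hlt
  have ht : 1 < t := by linarith
  have h1 : b + c < a * t := by
    have : (b + c) / a < t := by linarith
    rw [div_lt_iff₀ ha] at this
    linarith
  nlinarith

attribute [local irreducible] totalEnergy

/-- Coercivity: on sublevel sets, `J` and `curl A - J` are bounded if `A` is controlled by
`curl A`. -/
lemma exists_bound_of_totalEnergy_le (hΩ : Bornology.IsBounded (Ω : Set E3)) {ν₀ As Js χ ε : ℝ}
    (hν : 0 < ν₀) (hAs : 0 < As) (hJs : 0 < Js) (hχ : 0 ≤ χ) (hε : 0 ≤ ε) (js Jp : L2v Ω)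
    (k : ℝ≥0) : ∃ R : ℝ, ∀ c A J : L2v Ω, ‖A‖ ≤ k * ‖c‖ →
      totalEnergy Ω ν₀ As Js χ ε js Jp c A J ≤ totalEnergy Ω ν₀ As Js χ ε js Jp 0 0 0 →
        ‖A‖ ≤ R ∧ ‖J‖ ≤ R := by
  have hfin : IsFiniteMeasure ((volume : Measure E3).restrict (Ω : Set E3)) :=
    isFiniteMeasure_restrict.2 hΩ.measure_lt_top.ne
  have hF0 := nonnegEnergy_zero_lt_top hΩ (ν₀ := ν₀) (As := As) hJs hχ hε Jp
  obtain ⟨M, hM⟩ : ∃ M, M = (nonnegEnergy Ω ν₀ As Js χ ε Jp 0 0).toReal := ⟨_, rfl⟩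
  -- The `L²` bound `|Ω|^(1/2) J_s` implied by `|J| < J_s` almost everywhere.
  obtain ⟨R, hR⟩ : ∃ R, R = ((volume.restrict (Ω : Set E3)).real Set.univ)
    ^ ((2 : ℝ≥0∞).toReal)⁻¹ * Js := ⟨_, rfl⟩
  have hR0 : 0 ≤ R := by
    rw [hR]
    positivity
  have hM0 : 0 ≤ M := hM ▸ ENNReal.toReal_nonneg
  have hk : (0 : ℝ) ≤ k := k.2
  have hj : 0 ≤ ‖js‖ := norm_nonneg js
  -- With `t = ‖c - J‖`, the sublevel condition gives `ν₀ / 2 * t ^ 2 ≤ (M + ‖js‖ * k * R) + ‖js‖ *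
  -- k * t`. This bounds `t`, and `‖A‖ ≤ k * (t + R)`.
  refine ⟨max (k * (1 + (M + ‖js‖ * k * R + ‖js‖ * k) / (ν₀ / 2) + R)) R,
    fun c A J hA hp => ?_⟩
  obtain ⟨hFt, hle⟩ := (totalEnergy_le_iff hF0.ne).1 hp
  rw [inner_zero_right, sub_zero, ← hM] at hle
  have hJ : ‖J‖ ≤ R := by
    rw [hR]
    exact Lp.norm_le_of_ae_bound hJs.le
      ((ae_norm_lt_of_nonnegEnergy hAs hJs hFt).mono fun x hx => hx.le)
  have hc : ‖c‖ ≤ ‖c - J‖ + R := (norm_le_norm_sub_add c J).trans (by linarith)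
  have hsq : ν₀ / 2 * ‖c - J‖ ^ 2 ≤ M + inner ℝ js A := by
    have h1 := ENNReal.toReal_mono hFt
      (ofReal_norm_sq_le_nonnegEnergy (As := As) (Js := Js) (χ := χ) (ε := ε) hν Jp c J)
    rw [ENNReal.toReal_ofReal (by positivity)] at h1
    linarith
  have hAc : ‖A‖ ≤ k * (‖c - J‖ + R) := hA.trans (mul_le_mul_of_nonneg_left hc hk)
  have hjs : inner ℝ js A ≤ ‖js‖ * (k * (‖c - J‖ + R)) :=
    (real_inner_le_norm _ _).trans (mul_le_mul_of_nonneg_left hAc hj)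
  have hb : ‖c - J‖ ≤ 1 + (M + ‖js‖ * k * R + ‖js‖ * k) / (ν₀ / 2) :=
    le_of_mul_sq_le (by positivity) (by positivity) (by positivity) (by linarith)
  exact ⟨(hAc.trans (mul_le_mul_of_nonneg_left (by linarith) hk)).trans (le_max_left _ _),
    hJ.trans (le_max_right _ _)⟩

/-- Existence of a minimizer. -/
theorem exists_isMin_totalEnergy (hΩ : Bornology.IsBounded (Ω : Set E3)) (C : X →ₗ[ℝ] L2v Ω)
    (hC : LinearMap.ker C = ⊥) (a : X →ₗᵢ[ℝ] L2v Ω) (j : Y →ₗᵢ[ℝ] L2v Ω)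
    [FiniteDimensional ℝ X] [FiniteDimensional ℝ Y] {ν₀ As Js χ ε : ℝ} (hν : 0 < ν₀)
    (hAs : 0 < As) (hJs : 0 < Js) (hχ : 0 ≤ χ) (hε : 0 ≤ ε) (js Jp : L2v Ω) :
    ∃ p : X × Y, ∀ q : X × Y, totalEnergy Ω ν₀ As Js χ ε js Jp (C p.1) (a p.1) (j p.2)
      ≤ totalEnergy Ω ν₀ As Js χ ε js Jp (C q.1) (a q.1) (j q.2) := by
  have hprop : ProperSpace (X × Y) := FiniteDimensional.proper_real _
  -- An injective linear map on a finite-dimensional space is bounded below, which acts as a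
  -- discrete Poincaré inequality.
  obtain ⟨k, -, hkC⟩ := C.exists_antilipschitzWith hC
  have hk : ∀ v : X, ‖a v‖ ≤ k * ‖C v‖ := fun v => by
    have := hkC.le_mul_dist v 0
    rwa [map_zero, dist_zero_right, dist_zero_right, ← a.norm_map] at this
  obtain ⟨R, hR⟩ := exists_bound_of_totalEnergy_le hΩ hν hAs hJs hχ hε js Jp k
  have hCc : Continuous fun p : X × Y => C p.1 :=
    (LinearMap.continuous_of_finiteDimensional C).comp continuous_fst
  have hlsc := lowerSemicontinuous_totalEnergy (ν₀ := ν₀) (χ := χ) (ε := ε) hAs hJs js Jp hCc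
    (a.continuous.comp continuous_fst) (j.continuous.comp continuous_snd)
  obtain ⟨E, hE⟩ : ∃ E : X × Y → EReal, E = fun p =>
      totalEnergy Ω ν₀ As Js χ ε js Jp (C p.1) (a p.1) (j p.2) := ⟨_, rfl⟩
  have hEp : ∀ p, E p = totalEnergy Ω ν₀ As Js χ ε js Jp (C p.1) (a p.1) (j p.2) :=
    fun p => congrFun hE p
  have hlsc' : LowerSemicontinuous E := hE ▸ hlsc
  simp only [← hEp]
  have hE0 : E 0 = totalEnergy Ω ν₀ As Js χ ε js Jp 0 0 0 := by
    rw [hEp, Prod.fst_zero, Prod.snd_zero, map_zero, map_zero, map_zero]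
  have hScl : IsClosed {p | E p ≤ E 0} :=
    lowerSemicontinuous_iff_isClosed_preimage.1 hlsc' (E 0)
  have hSbd : Bornology.IsBounded {p | E p ≤ E 0} := by
    refine isBounded_iff_forall_norm_le.2 ⟨R, fun p hp => ?_⟩
    have hp' : E p ≤ E 0 := hp
    rw [hE0, hEp] at hp'
    obtain ⟨h1, h2⟩ := hR _ _ _ (hk p.1) hp'
    rw [a.norm_map] at h1
    rw [j.norm_map] at h2
    exact max_le h1 h2
  obtain ⟨p, hpS, hp⟩ := (hlsc'.lowerSemicontinuousOn _).exists_isMinOn ⟨0, le_refl (E 0)⟩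
    (Metric.isCompact_of_isClosed_isBounded hScl hSbd)
  refine ⟨p, fun q => ?_⟩
  rcases le_total (E q) (E 0) with h | h
  · exact hp h
  · exact le_trans hpS h

lemma coeFn_midpoint (f g : L2v Ω) : ∀ᵐ x ∂(volume.restrict (Ω : Set E3)),
    ((1 / 2 : ℝ) • (f + g) : L2v Ω) x = (1 / 2 : ℝ) • (f x + g x) := by
  filter_upwards [Lp.coeFn_smul (1 / 2 : ℝ) (f + g), Lp.coeFn_add f g] with x h1 h2
  rw [h1, Pi.smul_apply, h2, Pi.add_apply]

/-- The nonnegative part of the energy is strictly midpoint convex on its domain. -/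
lemma nonnegEnergy_midpoint {ν₀ As Js χ ε : ℝ} (hν : 0 < ν₀) (hAs : 0 < As) (hJs : 0 < Js)
    (hχ : 0 ≤ χ) (hε : 0 ≤ ε) {Jp c₁ c₂ J₁ J₂ : L2v Ω}
    (h₁ : nonnegEnergy Ω ν₀ As Js χ ε Jp c₁ J₁ ≠ ⊤)
    (h₂ : nonnegEnergy Ω ν₀ As Js χ ε Jp c₂ J₂ ≠ ⊤) :
    nonnegEnergy Ω ν₀ As Js χ ε Jp ((1 / 2 : ℝ) • (c₁ + c₂)) ((1 / 2 : ℝ) • (J₁ + J₂))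
      ≤ (nonnegEnergy Ω ν₀ As Js χ ε Jp c₁ J₁ + nonnegEnergy Ω ν₀ As Js χ ε Jp c₂ J₂) / 2 ∧
    ((nonnegEnergy Ω ν₀ As Js χ ε Jp c₁ J₁ + nonnegEnergy Ω ν₀ As Js χ ε Jp c₂ J₂) / 2
      ≤ nonnegEnergy Ω ν₀ As Js χ ε Jp ((1 / 2 : ℝ) • (c₁ + c₂)) ((1 / 2 : ℝ) • (J₁ + J₂)) →
        c₁ = c₂ ∧ J₁ = J₂) := by
  have hmid : ∀ᵐ x ∂(volume.restrict (Ω : Set E3)),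
      density ν₀ As Js χ ε (((1 / 2 : ℝ) • (c₁ + c₂) : L2v Ω) x)
          (((1 / 2 : ℝ) • (J₁ + J₂) : L2v Ω) x) (Jp x)
        ≤ (density ν₀ As Js χ ε (c₁ x) (J₁ x) (Jp x)
          + density ν₀ As Js χ ε (c₂ x) (J₂ x) (Jp x)) / 2 ∧
      (density ν₀ As Js χ ε (((1 / 2 : ℝ) • (c₁ + c₂) : L2v Ω) x)
          (((1 / 2 : ℝ) • (J₁ + J₂) : L2v Ω) x) (Jp x)
        = (density ν₀ As Js χ ε (c₁ x) (J₁ x) (Jp x)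
          + density ν₀ As Js χ ε (c₂ x) (J₂ x) (Jp x)) / 2 → c₁ x = c₂ x ∧ J₁ x = J₂ x) := by
    filter_upwards [coeFn_midpoint c₁ c₂, coeFn_midpoint J₁ J₂,
      ae_norm_lt_of_nonnegEnergy hAs hJs h₁, ae_norm_lt_of_nonnegEnergy hAs hJs h₂]
      with x e1 e2 h3 h4
    rw [e1, e2]
    exact density_midpoint hν hAs hJs hχ hε h3 h4
  have m₁ := aemeasurable_density (ν₀ := ν₀) (χ := χ) (ε := ε) hAs hJs c₁ J₁ Jp
  have m₂ := aemeasurable_density (ν₀ := ν₀) (χ := χ) (ε := ε) hAs hJs c₂ J₂ Jp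
  have m₃ : AEMeasurable (fun x => (density ν₀ As Js χ ε (c₁ x) (J₁ x) (Jp x)
      + density ν₀ As Js χ ε (c₂ x) (J₂ x) (Jp x)) / 2) (volume.restrict (Ω : Set E3)) :=
    (m₁.add m₂).div_const 2
  have hint : ∫⁻ x in (Ω : Set E3), (density ν₀ As Js χ ε (c₁ x) (J₁ x) (Jp x)
        + density ν₀ As Js χ ε (c₂ x) (J₂ x) (Jp x)) / 2
      = (nonnegEnergy Ω ν₀ As Js χ ε Jp c₁ J₁ + nonnegEnergy Ω ν₀ As Js χ ε Jp c₂ J₂) / 2 := by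
    have m₄ : AEMeasurable (fun x => density ν₀ As Js χ ε (c₁ x) (J₁ x) (Jp x)
      + density ν₀ As Js χ ε (c₂ x) (J₂ x) (Jp x)) (volume.restrict (Ω : Set E3)) := m₁.add m₂
    simp only [div_eq_mul_inv, nonnegEnergy]
    rw [lintegral_mul_const'' _ m₄, lintegral_add_left' m₁]
  have hle := lintegral_mono_ae (hmid.mono fun x hx => hx.1)
  rw [hint] at hle
  refine ⟨hle, fun hge => ?_⟩
  have hfin := ne_top_of_le_ne_top
    (ENNReal.div_ne_top (ENNReal.add_ne_top.2 ⟨h₁, h₂⟩) two_ne_zero) hle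
  -- A pointwise inequality with equal finite integrals is an equality almost everywhere, so the
  -- pointwise strictness applies.
  have hae := ae_eq_of_ae_le_of_lintegral_le (hmid.mono fun x hx => hx.1) hfin m₃
    (hint.trans_le hge)
  have hfinal : ∀ᵐ x ∂(volume.restrict (Ω : Set E3)), c₁ x = c₂ x ∧ J₁ x = J₂ x := by
    filter_upwards [hmid, hae] with x h1 h2 using h1.2 h2
  exact ⟨Lp.ext (hfinal.mono fun x hx => hx.1), Lp.ext (hfinal.mono fun x hx => hx.2)⟩

/-- Two points at which the total energy is finite and does not exceed its value at the midpoint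
agree. -/
lemma eq_of_totalEnergy_le_midpoint {ν₀ As Js χ ε : ℝ} (hν : 0 < ν₀) (hAs : 0 < As)
    (hJs : 0 < Js) (hχ : 0 ≤ χ) (hε : 0 ≤ ε) {js Jp c₁ c₂ A₁ A₂ J₁ J₂ : L2v Ω}
    (h₁ : nonnegEnergy Ω ν₀ As Js χ ε Jp c₁ J₁ ≠ ⊤)
    (h₂ : nonnegEnergy Ω ν₀ As Js χ ε Jp c₂ J₂ ≠ ⊤)
    (hle₁ : totalEnergy Ω ν₀ As Js χ ε js Jp c₁ A₁ J₁ ≤ totalEnergy Ω ν₀ As Js χ ε js Jp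
      ((1 / 2 : ℝ) • (c₁ + c₂)) ((1 / 2 : ℝ) • (A₁ + A₂)) ((1 / 2 : ℝ) • (J₁ + J₂)))
    (hle₂ : totalEnergy Ω ν₀ As Js χ ε js Jp c₂ A₂ J₂ ≤ totalEnergy Ω ν₀ As Js χ ε js Jp
      ((1 / 2 : ℝ) • (c₁ + c₂)) ((1 / 2 : ℝ) • (A₁ + A₂)) ((1 / 2 : ℝ) • (J₁ + J₂))) :
    c₁ = c₂ ∧ J₁ = J₂ := by
  obtain ⟨hle, heq⟩ := nonnegEnergy_midpoint hν hAs hJs hχ hε h₁ h₂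
  have hsum := ENNReal.div_ne_top (ENNReal.add_ne_top.2 ⟨h₁, h₂⟩) two_ne_zero
  have hm := ne_top_of_le_ne_top hsum hle
  have h3 := (totalEnergy_le_iff hm).1 hle₁ |>.2
  have h4 := (totalEnergy_le_iff hm).1 hle₂ |>.2
  -- Averaging `h3` and `h4` cancels the linear term and leaves the reverse of midpoint convexity.
  refine heq ?_
  rw [inner_smul_right, inner_add_right] at h3 h4
  rw [← ENNReal.toReal_le_toReal hsum hm, ENNReal.toReal_div, ENNReal.toReal_add h₁ h₂,
    ENNReal.toReal_ofNat]
  linarith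

/-- Uniqueness of the minimizer. -/
theorem eq_of_isMin_totalEnergy (hΩ : Bornology.IsBounded (Ω : Set E3)) (C : X →ₗ[ℝ] L2v Ω)
    (hC : LinearMap.ker C = ⊥) (a : X →ₗᵢ[ℝ] L2v Ω) (j : Y →ₗᵢ[ℝ] L2v Ω) {ν₀ As Js χ ε : ℝ}
    (hν : 0 < ν₀) (hAs : 0 < As) (hJs : 0 < Js) (hχ : 0 ≤ χ) (hε : 0 ≤ ε) (js Jp : L2v Ω)
    {p q : X × Y}
    (hp : ∀ r : X × Y, totalEnergy Ω ν₀ As Js χ ε js Jp (C p.1) (a p.1) (j p.2)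
      ≤ totalEnergy Ω ν₀ As Js χ ε js Jp (C r.1) (a r.1) (j r.2))
    (hq : ∀ r : X × Y, totalEnergy Ω ν₀ As Js χ ε js Jp (C q.1) (a q.1) (j q.2)
      ≤ totalEnergy Ω ν₀ As Js χ ε js Jp (C r.1) (a r.1) (j r.2)) : p = q := by
  have hF0 := nonnegEnergy_zero_lt_top hΩ (ν₀ := ν₀) (As := As) hJs hχ hε Jp
  have hfinite : ∀ p : X × Y,
      (∀ r : X × Y, totalEnergy Ω ν₀ As Js χ ε js Jp (C p.1) (a p.1) (j p.2)
        ≤ totalEnergy Ω ν₀ As Js χ ε js Jp (C r.1) (a r.1) (j r.2)) →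
      nonnegEnergy Ω ν₀ As Js χ ε Jp (C p.1) (j p.2) ≠ ⊤ := by
    intro p hp
    have h0 := hp 0
    rw [Prod.fst_zero, Prod.snd_zero, map_zero, map_zero, map_zero] at h0
    exact ((totalEnergy_le_iff hF0.ne).1 h0).1
  have hpm := hp ((1 / 2 : ℝ) • (p.1 + q.1), (1 / 2 : ℝ) • (p.2 + q.2))
  have hqm := hq ((1 / 2 : ℝ) • (p.1 + q.1), (1 / 2 : ℝ) • (p.2 + q.2))
  simp only [map_smul, map_add] at hpm hqm
  obtain ⟨h1, h2⟩ := eq_of_totalEnergy_le_midpoint hν hAs hJs hχ hε (hfinite p hp) (hfinite q hq)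
    hpm hqm
  exact Prod.ext (LinearMap.ker_eq_bot.1 hC h1) (j.injective h2)

lemma discreteEnergy_eq (ν₀ As Js χ ε : ℝ) (js Jp A J : L2v Ω) :
    discreteEnergy Ω ν₀ As Js χ ε js Jp A J
      = totalEnergy Ω ν₀ As Js χ ε js Jp (weakCurl Ω A) A J := by
  simp only [totalEnergy, L2.inner_def, nonnegEnergy, density, discreteEnergy]

end Minimization

end HystFEM

end

/-! ### Specialization to `V_h` and `Q_h`. -/

theorem mainTheorem6
    (Ω : TopologicalSpace.Opens HystFEM.E3)
    (hΩ : HystFEM.IsBoundedLipschitzDomain Ω) (hΩtop : HystFEM.IsTopologicallyTrivial Ω)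
    (K : Geometry.SimplicialComplex ℝ HystFEM.E3) (hK : HystFEM.IsTetMesh Ω K)
    (Vh : Submodule ℝ (HystFEM.L2v Ω)) (hVh : HystFEM.IsGauged Ω K Vh)
    (ν₀ As Js χ : ℝ) (hν₀ : 0 < ν₀) (hAs : 0 < As) (hJs : 0 < Js) (hχ : 0 ≤ χ)
    (Hs js : HystFEM.L2v Ω) (hjs : HystFEM.IsWeakCurl Ω Hs js)
    (ε : ℝ) (hε : 0 ≤ ε) (Jp : HystFEM.L2v Ω) (hJp : Jp ∈ HystFEM.Qh Ω K) :
    ∃! p : HystFEM.L2v Ω × HystFEM.L2v Ω,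
      (p.1 ∈ Vh ∧ p.2 ∈ HystFEM.Qh Ω K) ∧
      ∀ A ∈ Vh, ∀ J ∈ HystFEM.Qh Ω K,
        HystFEM.discreteEnergy Ω ν₀ As Js χ ε js Jp p.1 p.2
          ≤ HystFEM.discreteEnergy Ω ν₀ As Js χ ε js Jp A J := by
  have hV : Vh ≤ HystFEM.nedelec Ω K := hVh.1 ▸ le_sup_right
  have hNfin := HystFEM.finiteDimensional_nedelec hΩ hK
  have hVfin : FiniteDimensional ℝ Vh := Submodule.finiteDimensional_of_le hV
  have hQfin := HystFEM.finiteDimensional_Qh hΩ hK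
  have hker := HystFEM.ker_curlMap_eq_bot hΩ hΩtop.2 hK hV hVh.2
  have hE : ∀ p : Vh × HystFEM.Qh Ω K,
      HystFEM.discreteEnergy Ω ν₀ As Js χ ε js Jp p.1 p.2
        = HystFEM.totalEnergy Ω ν₀ As Js χ ε js Jp (HystFEM.curlMap hV p.1)
            (Vh.subtypeₗᵢ p.1) ((HystFEM.Qh Ω K).subtypeₗᵢ p.2) :=
    fun p => HystFEM.discreteEnergy_eq ν₀ As Js χ ε js Jp p.1 p.2
  obtain ⟨p, hp⟩ := HystFEM.exists_isMin_totalEnergy hΩ.bounded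
    (HystFEM.curlMap hV) hker Vh.subtypeₗᵢ (HystFEM.Qh Ω K).subtypeₗᵢ hν₀ hAs hJs hχ hε js Jp
  refine ⟨(p.1, p.2), ⟨⟨p.1.2, p.2.2⟩, fun A hA J hJ => ?_⟩, ?_⟩
  · have := hp (⟨A, hA⟩, ⟨J, hJ⟩)
    rwa [← hE, ← hE] at this
  · rintro ⟨A, J⟩ ⟨⟨hA, hJ⟩, hmin⟩
    have h := HystFEM.eq_of_isMin_totalEnergy (p := ((⟨A, hA⟩, ⟨J, hJ⟩) : Vh × HystFEM.Qh Ω K)) hΩ.bounded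
      (HystFEM.curlMap hV) hker Vh.subtypeₗᵢ (HystFEM.Qh Ω K).subtypeₗᵢ hν₀ hAs hJs hχ hε js Jp (fun r => by
        rw [← hE, ← hE]
        exact hmin r.1 r.1.2 r.2 r.2.2) hp
    rw [← h]
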